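/- Let $A$ be a finite-dimensional (associative, unital) algebra over a field $k$, let $S\subseteq A$ be a $k$-subalgebra (containing $1_A$) which is a semisimple ring, and let $e\in S$ be an idempotent. Put $\overline{A}=A/AeA$. For a right $A$-module $N$ and a left $A$-module $M$ let $\mathrm{Tor}^{(A,S)}_n(N,M)=H_n\bigl(N\otimes_A\beta(A,S,A)\otimes_A M\bigr)$, where $\beta(A,S,A)$ is the bar complex of $A$ relative to $S$: it has terms $\beta_n=A^{\otimes_S (n+2)}$ for $n\ge 0$ and differentials $d_n(a_0\otimes\cdots\otimes a_{n+1})=\sum_{t=0}^{n}(-1)^t a_0\otimes\cdots\otimes a_ta_{t+1}\otimes\cdots\otimes a_{n+1}$ for $n\ge 1$. Then the following conditions are equivalent. 1. $AeA$ is $(A,S)$-stratifying, that is, $\mathrm{Tor}^{(A,S)}_n(\overline{A},\overline{A})=0$ for all $n\ge 1$. 2. $AeA$ is a strong idempotent ideal in the sense of Auslander–Platzeck–Todorov, that is, for all finitely generated left $\overline{A}$-modules $X,Y$ and all $i\ge 0$ the canonical map $\mathrm{Ext}^i_{\overline{A}}(X,Y)\to\mathrm{Ext}^i_A(X,Y)$,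 induced by restriction of scalars along $A\to\overline{A}$, is an isomorphism. 3. $A\to\overline{A}$ is a homological epimorphism in the sense of Geigle–Lenzing, that is, the multiplication map $\overline{A}\otimes_A\overline{A}\to\overline{A}$ is an isomorphism and $\mathrm{Tor}^A_n(\overline{A},\overline{A})=0$ for all $n\ge 1$. 4. $AeA$ is a stratifying ideal in the sense of Cline–Parshall–Scott, that is, the multiplication map $Ae\otimes_{eAe}eA\to AeA$ is an isomorphism and $\mathrm{Tor}^{eAe}_n(Ae,eA)=0$ for all $n\ge 1$. -/

import Mathlib

open CategoryTheory MulOpposite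

open scoped TensorProduct

universe u

noncomputable section

/-! ### Tensor products over a noncommutative ring -/

/-- The tensor product `N ⊗_R M` of a right `R`-module `N` (a module over `Rᵐᵒᵖ`) and a left
`R`-module `M`: the quotient of `N ⊗_ℤ M` by the relations `n r ⊗ m = n ⊗ r m`. -/
def BTensor (R : Type*) [Ring R] (N : Type*) [AddCommGroup N] [Module Rᵐᵒᵖ N]
    (M : Type*) [AddCommGroup M] [Module R M] : Type _ :=
  (N ⊗[ℤ] M) ⧸ AddSubgroup.closure
    {x : N ⊗[ℤ] M | ∃ (n : N) (r : R) (m : M), x = (op r • n) ⊗ₜ[ℤ] m - n ⊗ₜ[ℤ] (r • m)}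

namespace BTensor

section

variable (R : Type*) [Ring R]
  {N N' N'' : Type*} [AddCommGroup N] [Module Rᵐᵒᵖ N] [AddCommGroup N'] [Module Rᵐᵒᵖ N']
  [AddCommGroup N''] [Module Rᵐᵒᵖ N'']
  {M M' M'' : Type*} [AddCommGroup M] [Module R M] [AddCommGroup M'] [Module R M']
  [AddCommGroup M''] [Module R M'']

instance : AddCommGroup (BTensor R N M) :=
  inferInstanceAs (AddCommGroup ((N ⊗[ℤ] M) ⧸ AddSubgroup.closure
    {x : N ⊗[ℤ] M | ∃ (n : N) (r : R) (m : M), x = (op r • n) ⊗ₜ[ℤ] m - n ⊗ₜ[ℤ] (r • m)}))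

/-- The pure tensor `n ⊗ m`. -/
def tmul (n : N) (m : M) : BTensor R N M :=
  QuotientAddGroup.mk (n ⊗ₜ[ℤ] m)

lemma tmul_add (n : N) (m m' : M) : tmul R n (m + m') = tmul R n m + tmul R n m' := by
  simp only [tmul, TensorProduct.tmul_add]; rfl

lemma add_tmul (n n' : N) (m : M) : tmul R (n + n') m = tmul R n m + tmul R n' m := by
  simp only [tmul, TensorProduct.add_tmul]; rfl

lemma smul_tmul (r : R) (n : N) (m : M) : tmul R (op r • n) m = tmul R n (r • m) := by
  refine (QuotientAddGroup.eq_iff_sub_mem).2 (AddSubgroup.subset_closure ⟨n, r, m, rfl⟩)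

/-- The universal property: a biadditive map `f` with `f (n r) m = f n (r m)` factors through
`N ⊗_R M`. -/
def lift {P : Type*} [AddCommGroup P] (f : N →+ M →+ P)
    (hf : ∀ (n : N) (r : R) (m : M), f (op r • n) m = f n (r • m)) : BTensor R N M →+ P :=
  QuotientAddGroup.lift _
    (TensorProduct.liftAddHom f (fun r n m => by simp))
    ((AddSubgroup.closure_le _).2 (by
      rintro _ ⟨n, r, m, rfl⟩
      simp [hf]))

@[simp] lemma lift_tmul {P : Type*} [AddCommGroup P] (f : N →+ M →+ P)
    (hf : ∀ (n : N) (r : R) (m : M), f (op r • n) m = f n (r • m)) (n : N) (m : M) :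
    lift R f hf (tmul R n m) = f n m :=
  rfl

variable {R}

lemma induction_on {p : BTensor R N M → Prop} (x : BTensor R N M)
    (zero : p 0) (tmul : ∀ n m, p (tmul R n m)) (add : ∀ x y, p x → p y → p (x + y)) : p x := by
  induction x using QuotientAddGroup.induction_on with
  | H z =>
    induction z using TensorProduct.induction_on with
    | zero => exact zero
    | tmul n m => exact tmul n m
    | add a b ha hb => exact add _ _ ha hb

lemma addHom_ext {P : Type*} [AddCommGroup P] {f g : BTensor R N M →+ P}
    (h : ∀ n m, f (tmul R n m) = g (tmul R n m)) : f = g := by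
  ext x
  induction x using induction_on with
  | zero => simp
  | tmul n m => exact h n m
  | add a b ha hb => simp [ha, hb]

/-- The map `f ⊗ g : N ⊗_R M → N' ⊗_R M'`. -/
def map (f : N →ₗ[Rᵐᵒᵖ] N') (g : M →ₗ[R] M') : BTensor R N M →+ BTensor R N' M' :=
  lift R
    { toFun := fun n =>
        { toFun := fun m => tmul R (f n) (g m)
          map_zero' := by
            have h := tmul_add R (f n) (0 : M') 0
            simpa using h
          map_add' := fun a b => by rw [map_add, tmul_add] }
      map_zero' := by
        ext m
        have h := add_tmul R (0 : N') 0 (g m)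
        simpa using h
      map_add' := fun a b => by
        ext m
        simp [add_tmul] }
    (fun n r m => by
      change tmul R (f (op r • n)) (g m) = tmul R (f n) (g (r • m))
      rw [map_smul, map_smul, smul_tmul])

@[simp] lemma map_tmul (f : N →ₗ[Rᵐᵒᵖ] N') (g : M →ₗ[R] M') (n : N) (m : M) :
    map f g (tmul R n m) = tmul R (f n) (g m) :=
  lift_tmul R _ _ n m

lemma map_id : map (LinearMap.id : N →ₗ[Rᵐᵒᵖ] N) (LinearMap.id : M →ₗ[R] M) =
    AddMonoidHom.id _ :=
  addHom_ext (by simp)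

lemma map_comp (f' : N' →ₗ[Rᵐᵒᵖ] N'') (g' : M' →ₗ[R] M'') (f : N →ₗ[Rᵐᵒᵖ] N')
    (g : M →ₗ[R] M') : map (f' ∘ₗ f) (g' ∘ₗ g) = (map f' g').comp (map f g) :=
  addHom_ext (by simp)

lemma map_add_left (f f' : N →ₗ[Rᵐᵒᵖ] N') (g : M →ₗ[R] M') :
    map (f + f') g = map f g + map f' g :=
  addHom_ext (by simp [add_tmul])

lemma map_add_right (f : N →ₗ[Rᵐᵒᵖ] N') (g g' : M →ₗ[R] M') :
    map f (g + g') = map f g + map f g' :=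
  addHom_ext (by simp [tmul_add])

lemma map_zero_left (g : M →ₗ[R] M') : map (0 : N →ₗ[Rᵐᵒᵖ] N') g = 0 := by
  simpa using map_add_left (0 : N →ₗ[Rᵐᵒᵖ] N') 0 g

lemma map_zero_right (f : N →ₗ[Rᵐᵒᵖ] N') : map f (0 : M →ₗ[R] M') = 0 := by
  simpa using map_add_right f (0 : M →ₗ[R] M') 0

end

section

variable {R : Type*} [Ring R] {N : Type*} [AddCommGroup N] [Module Rᵐᵒᵖ N]
  {M : Type*} [AddCommGroup M] [Module R M]

/-- If `N` is a `(T, R)`-bimodule, then `N ⊗_R M` is a left `T`-module: `t (n ⊗ m) = t n ⊗ m`. -/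
instance leftModule {T : Type*} [Ring T] [Module T N] [SMulCommClass T Rᵐᵒᵖ N] :
    Module T (BTensor R N M) where
  smul t x := map (DistribSMul.toLinearMap Rᵐᵒᵖ N t) LinearMap.id x
  one_smul x := by
    change map (DistribSMul.toLinearMap Rᵐᵒᵖ N (1 : T)) LinearMap.id x = x
    induction x using induction_on with
    | zero => simp
    | tmul n m => simp
    | add a b ha hb => simp [ha, hb]
  mul_smul s t x := by
    change map (DistribSMul.toLinearMap Rᵐᵒᵖ N (s * t)) LinearMap.id x =
      map (DistribSMul.toLinearMap Rᵐᵒᵖ N s) LinearMap.id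
        (map (DistribSMul.toLinearMap Rᵐᵒᵖ N t) LinearMap.id x)
    induction x using induction_on with
    | zero => simp
    | tmul n m => simp [mul_smul]
    | add a b ha hb => simp [ha, hb]
  smul_zero t := map_zero _
  smul_add t x y := map_add _ x y
  add_smul s t x := by
    change map (DistribSMul.toLinearMap Rᵐᵒᵖ N (s + t)) LinearMap.id x =
      map (DistribSMul.toLinearMap Rᵐᵒᵖ N s) LinearMap.id x +
        map (DistribSMul.toLinearMap Rᵐᵒᵖ N t) LinearMap.id x
    induction x using induction_on with
    | zero => simp
    | tmul n m => simp [add_smul, add_tmul]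
    | add a b ha hb => rw [map_add, map_add, map_add, ha, hb]; abel
  zero_smul x := by
    change map (DistribSMul.toLinearMap Rᵐᵒᵖ N (0 : T)) LinearMap.id x = 0
    have h : DistribSMul.toLinearMap Rᵐᵒᵖ N (0 : T) = 0 := by ext; simp
    rw [h, map_zero_left]; rfl

/-- If `M` is an `(R, T)`-bimodule, then `N ⊗_R M` is a right `T`-module:
`(n ⊗ m) t = n ⊗ m t`. -/
instance rightModule {T : Type*} [Ring T] [Module Tᵐᵒᵖ M] [SMulCommClass R Tᵐᵒᵖ M] :
    Module Tᵐᵒᵖ (BTensor R N M) :=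
  haveI : SMulCommClass Tᵐᵒᵖ R M := SMulCommClass.symm _ _ _
  { smul := fun t x => map LinearMap.id (DistribSMul.toLinearMap R M t) x
    one_smul := fun x => by
      change map LinearMap.id (DistribSMul.toLinearMap R M (1 : Tᵐᵒᵖ)) x = x
      induction x using induction_on with
      | zero => simp
      | tmul n m => simp
      | add a b ha hb => simp [ha, hb]
    mul_smul := fun s t x => by
      change map LinearMap.id (DistribSMul.toLinearMap R M (s * t)) x =
        map LinearMap.id (DistribSMul.toLinearMap R M s)
          (map LinearMap.id (DistribSMul.toLinearMap R M t) x)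
      induction x using induction_on with
      | zero => simp
      | tmul n m => simp [mul_smul]
      | add a b ha hb => simp [ha, hb]
    smul_zero := fun t => map_zero _
    smul_add := fun t x y => map_add _ x y
    add_smul := fun s t x => by
      change map LinearMap.id (DistribSMul.toLinearMap R M (s + t)) x =
        map LinearMap.id (DistribSMul.toLinearMap R M s) x +
          map LinearMap.id (DistribSMul.toLinearMap R M t) x
      induction x using induction_on with
      | zero => simp
      | tmul n m => simp [add_smul, tmul_add]
      | add a b ha hb => rw [map_add, map_add, map_add, ha, hb]; abel
    zero_smul := fun x => by
      change map LinearMap.id (DistribSMul.toLinearMap R M (0 : Tᵐᵒᵖ)) x = 0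
      have h : DistribSMul.toLinearMap R M (0 : Tᵐᵒᵖ) = 0 := by ext; simp
      rw [h, map_zero_right]; rfl }

lemma left_smul_tmul {T : Type*} [Ring T] [Module T N] [SMulCommClass T Rᵐᵒᵖ N]
    (t : T) (n : N) (m : M) : t • tmul R n m = tmul R (t • n) m :=
  map_tmul _ _ n m

lemma right_smul_tmul {T : Type*} [Ring T] [Module Tᵐᵒᵖ M] [SMulCommClass R Tᵐᵒᵖ M]
    (t : Tᵐᵒᵖ) (n : N) (m : M) : t • tmul R n m = tmul R n (t • m) :=
  haveI : SMulCommClass Tᵐᵒᵖ R M := SMulCommClass.symm _ _ _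
  map_tmul LinearMap.id (DistribSMul.toLinearMap R M t) n m

instance {T U : Type*} [Ring T] [Module T N] [SMulCommClass T Rᵐᵒᵖ N]
    [Ring U] [Module Uᵐᵒᵖ M] [SMulCommClass R Uᵐᵒᵖ M] :
    SMulCommClass T Uᵐᵒᵖ (BTensor R N M) where
  smul_comm t v x := by
    induction x using induction_on with
    | zero => simp
    | tmul n m => simp only [left_smul_tmul, right_smul_tmul]
    | add a b ha hb => simp only [smul_add, ha, hb]

end

end BTensor

/-- The functor `N ⊗_R -` from left `R`-modules to abelian groups, for a right `R`-module `N`. -/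
def tensorFunctor {R : Type u} [Ring R] (N : ModuleCat.{u} Rᵐᵒᵖ) :
    ModuleCat.{u} R ⥤ AddCommGrpCat.{u} where
  obj M := AddCommGrpCat.of (BTensor R N M)
  map f := AddCommGrpCat.ofHom (BTensor.map LinearMap.id f.hom)
  map_id M := by
    ext1
    exact BTensor.map_id
  map_comp f g := by
    ext1
    exact BTensor.map_comp LinearMap.id g.hom LinearMap.id f.hom

instance {R : Type u} [Ring R] (N : ModuleCat.{u} Rᵐᵒᵖ) : (tensorFunctor N).Additive where
  map_add {X Y f g} := by
    ext1
    exact BTensor.map_add_right LinearMap.id f.hom g.hom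

/-- `Tor_n^R(N, M)`: the `n`-th left derived functor of `N ⊗_R -`, evaluated at `M`. -/
def torGroup (R : Type u) [Ring R] (n : ℕ) (N : ModuleCat.{u} Rᵐᵒᵖ) (M : ModuleCat.{u} R) :
    AddCommGrpCat.{u} :=
  ((tensorFunctor N).leftDerived n).obj M

/-! ### The bar resolution and relative Tor -/

/-- Bundled `(A, B)`-bimodules. -/
structure BimoduleObj (A B : Type u) [Ring A] [Ring B] : Type (u + 1) where
  carrier : Type u
  [addCommGroup : AddCommGroup carrier]
  [leftMod : Module A carrier]
  [rightMod : Module Bᵐᵒᵖ carrier]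
  [smulComm : SMulCommClass A Bᵐᵒᵖ carrier]

attribute [instance] BimoduleObj.addCommGroup BimoduleObj.leftMod BimoduleObj.rightMod
  BimoduleObj.smulComm

/-- Homomorphisms of bimodules. -/
structure BimoduleHom {A B : Type u} [Ring A] [Ring B] (X Y : BimoduleObj A B) : Type u where
  left : X.carrier →ₗ[A] Y.carrier
  map_right : ∀ (b : Bᵐᵒᵖ) (x : X.carrier), left (b • x) = b • left x

/-- A bimodule homomorphism as a homomorphism of right modules. -/
def BimoduleHom.right {A B : Type u} [Ring A] [Ring B] {X Y : BimoduleObj A B}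
    (f : BimoduleHom X Y) : X.carrier →ₗ[Bᵐᵒᵖ] Y.carrier where
  toFun := f.left
  map_add' := map_add f.left
  map_smul' := f.map_right

section Bar

variable {A : Type u} [Ring A] (S : Subring A)

/-- `A` as a right module over a subring `S`. -/
instance subringRightModule : Module (↥S)ᵐᵒᵖ A := Module.compHom A (RingHom.op S.subtype)

lemma subring_op_smul (s : S) (a : A) : op s • a = a * (s : A) := rfl

instance subringRightModule_comm : SMulCommClass A (↥S)ᵐᵒᵖ A where
  smul_comm a s b := (mul_assoc a b (s.unop : A)).symm

/-- The induced left `A`-module `A ⊗_S X` of a left `A`-module `X`, where `S` acts on `X` by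
restriction. -/
def IndTensor (X : Type u) [AddCommGroup X] [Module A X] : Type u := BTensor S A X

namespace IndTensor

variable {X Y : Type u} [AddCommGroup X] [Module A X] [AddCommGroup Y] [Module A Y]

instance : AddCommGroup (IndTensor S X) := inferInstanceAs (AddCommGroup (BTensor S A X))

instance : Module A (IndTensor S X) := inferInstanceAs (Module A (BTensor S A X))

instance {B : Type u} [Ring B] [Module Bᵐᵒᵖ X] [SMulCommClass A Bᵐᵒᵖ X] :
    Module Bᵐᵒᵖ (IndTensor S X) :=
  haveI : SMulCommClass S Bᵐᵒᵖ X := ⟨fun s b x => smul_comm (s : A) b x⟩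
  inferInstanceAs (Module Bᵐᵒᵖ (BTensor S A X))

instance {B : Type u} [Ring B] [Module Bᵐᵒᵖ X] [SMulCommClass A Bᵐᵒᵖ X] :
    SMulCommClass A Bᵐᵒᵖ (IndTensor S X) :=
  haveI : SMulCommClass S Bᵐᵒᵖ X := ⟨fun s b x => smul_comm (s : A) b x⟩
  inferInstanceAs (SMulCommClass A Bᵐᵒᵖ (BTensor S A X))

/-- The pure tensor `a ⊗ x`. -/
def tmul (a : A) (x : X) : IndTensor S X := BTensor.tmul S a x

lemma tmul_zero (a : A) : tmul S a (0 : X) = 0 := by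
  have h : tmul S a (0 + 0 : X) = tmul S a 0 + tmul S a 0 := BTensor.tmul_add S a 0 0
  simpa using h

lemma smul_tmul (a b : A) (x : X) : a • tmul S b x = tmul S (a * b) x :=
  BTensor.left_smul_tmul a b x

lemma op_smul_tmul {B : Type u} [Ring B] [Module Bᵐᵒᵖ X] [SMulCommClass A Bᵐᵒᵖ X]
    (b : Bᵐᵒᵖ) (a : A) (x : X) : b • tmul S a x = tmul S a (b • x) :=
  haveI : SMulCommClass S Bᵐᵒᵖ X := ⟨fun s b x => smul_comm (s : A) b x⟩
  BTensor.right_smul_tmul b a x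

variable {S}

lemma induction_on {p : IndTensor S X → Prop} (x : IndTensor S X)
    (zero : p 0) (tmul : ∀ a x, p (tmul S a x)) (add : ∀ x y, p x → p y → p (x + y)) : p x :=
  BTensor.induction_on x zero tmul add

variable (S)

/-- The multiplication map `A ⊗_S X → X`, `a ⊗ x ↦ a x`. -/
def mul (X : Type u) [AddCommGroup X] [Module A X] : IndTensor S X →ₗ[A] X :=
  let f : IndTensor S X →+ X := BTensor.lift (N := A) (M := X) S
    (AddMonoidHom.mk' (fun a : A => DistribSMul.toAddMonoidHom X a)
      (fun a b => AddMonoidHom.ext fun x => add_smul a b x))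
    (fun a s x => mul_smul a (s : A) x)
  { toFun := f
    map_add' := map_add f
    map_smul' := fun a x => by
      induction x using induction_on with
      | zero => simp
      | tmul b x =>
        rw [smul_tmul]
        exact mul_smul a b x
      | add x y hx hy => rw [smul_add, map_add, map_add, smul_add, hx, hy] }

@[simp] lemma mul_tmul (a : A) (x : X) : mul S X (tmul S a x) = a • x := rfl

/-- The map `A ⊗_S f : A ⊗_S X → A ⊗_S Y`. -/
def map (f : X →ₗ[A] Y) : IndTensor S X →ₗ[A] IndTensor S Y :=
  let g : IndTensor S X →+ IndTensor S Y :=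
    BTensor.map (N := A) (N' := A) (LinearMap.id)
      ({ toFun := f
         map_add' := map_add f
         map_smul' := fun s x => map_smul f (s : A) x } : X →ₗ[S] Y)
  { toFun := g
    map_add' := map_add g
    map_smul' := fun a x => by
      induction x using induction_on with
      | zero => simp
      | tmul b x =>
        rw [smul_tmul]
        exact (smul_tmul S a b (f x)).symm
      | add x y hx hy => rw [smul_add, map_add, map_add, smul_add, hx, hy] }

@[simp] lemma map_tmul (f : X →ₗ[A] Y) (a : A) (x : X) :
    map S f (tmul S a x) = tmul S a (f x) := rfl

end IndTensor

/-- `A ⊗_S X` for an `(A, B)`-bimodule `X`, with `A` acting on the left factor and `B` on the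
right one. -/
def inducedBimodule {B : Type u} [Ring B] (X : BimoduleObj A B) : BimoduleObj A B where
  carrier := IndTensor S X.carrier

/-- The multiplication map `A ⊗_S X → X` as a homomorphism of bimodules. -/
def inducedMul {B : Type u} [Ring B] (X : BimoduleObj A B) :
    BimoduleHom (inducedBimodule S X) X where
  left := IndTensor.mul S X.carrier
  map_right b x := by
    change IndTensor S X.carrier at x
    change IndTensor.mul S X.carrier (b • x) = b • IndTensor.mul S X.carrier x
    induction x using IndTensor.induction_on with
    | zero => simp
    | tmul a x =>
      rw [IndTensor.op_smul_tmul, IndTensor.mul_tmul, IndTensor.mul_tmul, smul_comm]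
    | add x y hx hy => rw [smul_add, map_add, map_add, smul_add, hx, hy]

/-- The map `A ⊗_S f : A ⊗_S X → A ⊗_S Y` as a homomorphism of bimodules. -/
def inducedMap {B : Type u} [Ring B] {X Y : BimoduleObj A B} (f : BimoduleHom X Y) :
    BimoduleHom (inducedBimodule S X) (inducedBimodule S Y) where
  left := IndTensor.map S f.left
  map_right b x := by
    change IndTensor S X.carrier at x
    change IndTensor.map S f.left (b • x) = b • IndTensor.map S f.left x
    induction x using IndTensor.induction_on with
    | zero => simp
    | tmul a x =>
      rw [IndTensor.op_smul_tmul, IndTensor.map_tmul, IndTensor.map_tmul, IndTensor.op_smul_tmul,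
        f.map_right]
    | add x y hx hy => rw [smul_add, map_add, map_add, smul_add, hx, hy]

/-- The difference of two bimodule homomorphisms. -/
def BimoduleHom.sub {A B : Type u} [Ring A] [Ring B] {X Y : BimoduleObj A B}
    (f g : BimoduleHom X Y) : BimoduleHom X Y where
  left := f.left - g.left
  map_right b x := by simp [f.map_right, g.map_right, smul_sub]

/-- The terms of the bar resolution `B(A, S, A)` of `A`, shifted by one: `barObj S k` is
`B_{k-1}(A, S, A)`, so that `barObj S 0 = A` and
`barObj S k = A ⊗_S ⋯ ⊗_S A` with `k + 1` tensor factors. -/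
def barObj : ℕ → BimoduleObj A A
  | 0 => { carrier := A }
  | k + 1 => inducedBimodule S (barObj k)

/-- The differentials of the bar resolution: `barD S k` is `d_k : B_k → B_{k-1}`, with
`d_k (a₀ ⊗ ⋯ ⊗ a_{k+1}) = ∑_{t = 0}^{k} (-1)^t a₀ ⊗ ⋯ ⊗ a_t a_{t+1} ⊗ ⋯ ⊗ a_{k+1}`. The sum is
written recursively: `d_{k+1} (a ⊗ x) = a x - a ⊗ d_k x`. -/
def barD : ∀ k : ℕ, BimoduleHom (barObj S (k + 1)) (barObj S k)
  | 0 => inducedMul S (barObj S 0)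
  | k + 1 => (inducedMul S (barObj S (k + 1))).sub (inducedMap S (barD k))

lemma mul_sub_map_tmul {X : Type u} [AddCommGroup X] [Module A X]
    (f : IndTensor S X →ₗ[A] X) (a : A) (x : IndTensor S X) :
    (IndTensor.mul S (IndTensor S X) - IndTensor.map S f) (IndTensor.tmul S a x) =
      a • x - IndTensor.tmul S a (f x) := by
  rw [LinearMap.sub_apply, IndTensor.mul_tmul, IndTensor.map_tmul]

lemma comp_mul_sub_map {X : Type u} [AddCommGroup X] [Module A X]
    (f : IndTensor S X →ₗ[A] X) (hf : ∀ a x, f (IndTensor.tmul S a (f x)) = a • f x)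
    (y : IndTensor S (IndTensor S X)) :
    f ((IndTensor.mul S (IndTensor S X) - IndTensor.map S f) y) = 0 := by
  induction y using IndTensor.induction_on with
  | zero => rw [map_zero, map_zero]
  | tmul a x => rw [mul_sub_map_tmul, map_sub, map_smul, hf, sub_self]
  | add x y hx hy => rw [map_add, map_add, hx, hy, add_zero]

lemma barD_tmul_barD (k : ℕ) (a : A) (x : IndTensor S (barObj S k).carrier) :
    (barD S k).left (IndTensor.tmul S a ((barD S k).left x)) = a • (barD S k).left x := by
  induction k generalizing a with
  | zero => exact IndTensor.mul_tmul S a _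
  | succ k ih =>
    let d : IndTensor S (barObj S k).carrier →ₗ[A] (barObj S k).carrier := (barD S k).left
    refine (mul_sub_map_tmul S d a _).trans ?_
    have h := comp_mul_sub_map S d (fun a x => ih a x) x
    have h1 : IndTensor.tmul S a (d ((barD S (k + 1)).left x)) = 0 :=
      (congrArg (IndTensor.tmul S a) h).trans (IndTensor.tmul_zero S a)
    rw [h1]
    exact sub_zero _

lemma barD_comp (k : ℕ) (x : (barObj S (k + 2)).carrier) :
    (barD S k).left ((barD S (k + 1)).left x) = 0 :=
  comp_mul_sub_map S (barD S k).left (fun a x => barD_tmul_barD S k a x) x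

/-- The map of left `A`-modules `f ⊗_B M : X ⊗_B M → Y ⊗_B M`. -/
def BimoduleHom.tensorRight {A B : Type u} [Ring A] [Ring B] {X Y : BimoduleObj A B}
    (f : BimoduleHom X Y) (M : Type u) [AddCommGroup M] [Module B M] :
    BTensor B X.carrier M →ₗ[A] BTensor B Y.carrier M where
  toFun := BTensor.map f.right LinearMap.id
  map_add' := map_add _
  map_smul' a x := by
    induction x using BTensor.induction_on with
    | zero => simp
    | tmul x m =>
      rw [BTensor.left_smul_tmul, BTensor.map_tmul, RingHom.id_apply, BTensor.map_tmul,
        BTensor.left_smul_tmul]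
      congr 1
      exact map_smul f.left a x
    | add x y hx hy => rw [smul_add, map_add, map_add, smul_add, hx, hy]

/-- The complex of left `A`-modules `β(A, S, A) ⊗_A M`, where `β(A, S, A)` is the bar resolution
of `A` with the term in degree `-1` deleted. -/
def barTensor (M : ModuleCat.{u} A) : ChainComplex (ModuleCat.{u} A) ℕ :=
  ChainComplex.of (fun k => ModuleCat.of A (BTensor A (barObj S (k + 1)).carrier M))
    (fun k => ModuleCat.ofHom ((barD S (k + 1)).tensorRight M))
    (fun k => by
      ext x
      change BTensor.map _ _ (BTensor.map _ _ x) = 0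
      induction x using BTensor.induction_on with
      | zero => simp
      | tmul x m =>
        rw [BTensor.map_tmul, BTensor.map_tmul]
        have h : (barD S (k + 1)).right ((barD S (k + 1 + 1)).right x) = 0 :=
          barD_comp S (k + 1) x
        rw [h]
        simpa using BTensor.add_tmul A (0 : (barObj S (k + 1)).carrier) 0 m
      | add x y hx hy => rw [map_add, map_add, hx, hy, add_zero])

/-- The relative Tor group `Tor_k^{(A, S)}(N, M) = H_k (N ⊗_A β(A, S, A) ⊗_A M)`. -/
def relTor (k : ℕ) (N : ModuleCat.{u} Aᵐᵒᵖ) (M : ModuleCat.{u} A) : AddCommGrpCat.{u} :=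
  (((tensorFunctor N).mapHomologicalComplex (ComplexShape.down ℕ)).obj (barTensor S M)).homology k

end Bar

/-! ### The four conditions -/

section Conditions

variable {A : Type u} [Ring A]

/-- The two-sided ideal `AeA`. -/
def idealAeA (e : A) : Ideal A := Ideal.span (Set.range fun p : A × A => p.1 * e * p.2)

instance (e : A) : (idealAeA e).IsTwoSided where
  mul_mem_of_left {a} b ha := by
    refine Submodule.span_induction (p := fun x _ => x * b ∈ idealAeA e) ?_ ?_ ?_ ?_ ha
    · rintro _ ⟨⟨c, d⟩, rfl⟩
      exact Ideal.subset_span ⟨(c, d * b), by simp [mul_assoc]⟩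
    · simp
    · intro x y _ _ hx hy
      rw [add_mul]
      exact add_mem hx hy
    · intro c x _ hx
      rw [smul_eq_mul, mul_assoc]
      exact Ideal.mul_mem_left _ c hx

/-- For a ring homomorphism `φ : A → B`, the ring `B` as a left `A`-module. -/
abbrev leftVia {B : Type u} [Ring B] (φ : A →+* B) : ModuleCat.{u} A :=
  (ModuleCat.restrictScalars φ).obj (ModuleCat.of B B)

/-- For a ring homomorphism `φ : A → B`, the ring `B` as a right `A`-module. -/
abbrev rightVia {B : Type u} [Ring B] (φ : A →+* B) : ModuleCat.{u} Aᵐᵒᵖ :=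
  (ModuleCat.restrictScalars (RingHom.op φ)).obj (ModuleCat.of Bᵐᵒᵖ B)

/-- `AeA` is `(A, S)`-stratifying: `Tor_k^{(A, S)}(A/AeA, A/AeA) = 0` for all `k ≥ 1`. -/
def IsRelStratifying (S : Subring A) (e : A) : Prop :=
  ∀ k : ℕ, 1 ≤ k →
    Limits.IsZero (relTor S k (rightVia (Ideal.Quotient.mk (idealAeA e)))
      (leftVia (Ideal.Quotient.mk (idealAeA e))))

lemma restrictScalars_map_exact' {B : Type u} [Ring B] (φ : A →+* B)
    (C : ShortComplex (ModuleCat.{u} B)) (h : C.Exact) :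
    (C.map (ModuleCat.restrictScalars.{u} φ)).Exact := by
  rw [ShortComplex.ShortExact.moduleCat_exact_iff_function_exact] at h ⊢
  exact h

instance restrictScalars_preservesFiniteLimits {B : Type u} [Ring B] (φ : A →+* B) :
    Limits.PreservesFiniteLimits (ModuleCat.restrictScalars.{u} φ) := by
  have h := ((Functor.exact_tfae (ModuleCat.restrictScalars.{u} φ)).out 1 3).mp
    (restrictScalars_map_exact' φ)
  exact h.1

instance restrictScalars_preservesFiniteColimits {B : Type u} [Ring B] (φ : A →+* B) :
    Limits.PreservesFiniteColimits (ModuleCat.restrictScalars.{u} φ) := by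
  have h := ((Functor.exact_tfae (ModuleCat.restrictScalars.{u} φ)).out 1 3).mp
    (restrictScalars_map_exact' φ)
  exact h.2

/-- A two-sided ideal `I` is a strong idempotent ideal (Auslander, Platzeck, Todorov): for all
finitely generated `A/I`-modules `X`, `Y` and all `i ≥ 0` the canonical map
`Ext^i_{A/I}(X, Y) → Ext^i_A(X, Y)`, induced by restriction of scalars, is an isomorphism. -/
def IsStrongIdempotentIdeal (I : Ideal A) [I.IsTwoSided] : Prop :=
  ∀ (X Y : ModuleCat.{u} (A ⧸ I)), Module.Finite (A ⧸ I) X → Module.Finite (A ⧸ I) Y →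
    ∀ i : ℕ, Function.Bijective
      ((ModuleCat.restrictScalars.{u} (Ideal.Quotient.mk I)).mapExtAddHom X Y i)

/-- The multiplication map `B ⊗_A B → B` of a ring homomorphism `φ : A → B`. -/
def epiMul {B : Type u} [Ring B] (φ : A →+* B) :
    BTensor A (rightVia φ) (leftVia φ) →+ B :=
  BTensor.lift (N := rightVia φ) (M := leftVia φ) A (AddMonoidHom.mul : B →+ B →+ B)
    (fun b a c => mul_assoc (G := B) b (φ a) c)

/-- `φ : A → B` is a homological epimorphism (Geigle, Lenzing): the multiplication map
`B ⊗_A B → B` is an isomorphism and `Tor_n^A(B, B) = 0` for all `n ≥ 1`. -/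
def IsHomologicalEpi {B : Type u} [Ring B] (φ : A →+* B) : Prop :=
  Function.Bijective (epiMul φ) ∧
    ∀ n : ℕ, 1 ≤ n → Limits.IsZero (torGroup A n (rightVia φ) (leftVia φ))

/-- The additive group `Ae`. -/
abbrev groupAe (e : A) : AddSubgroup A := (AddMonoidHom.mulRight e).range

/-- The additive group `eA`. -/
abbrev groupEA (e : A) : AddSubgroup A := (AddMonoidHom.mulLeft e).range

/-- `Ae` is a right module over the ring `eAe`. -/
instance cornerRightModule {e : A} (he : IsIdempotentElem e) :
    Module (he.Corner)ᵐᵒᵖ (groupAe e) where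
  smul c x := ⟨x.1 * c.unop.1, x.1 * c.unop.1, by
    have h := ((Subsemigroup.mem_corner_iff he).mp c.unop.2).2
    change x.1 * c.unop.1 * e = _
    rw [mul_assoc, h]⟩
  one_smul x := by
    obtain ⟨_, a, rfl⟩ := x
    refine Subtype.ext ?_
    change a * e * e = a * e
    rw [mul_assoc, he.eq]
  mul_smul c d x := Subtype.ext (mul_assoc x.1 d.unop.1 c.unop.1).symm
  smul_zero c := Subtype.ext (zero_mul _)
  smul_add c x y := Subtype.ext (add_mul _ _ _)
  add_smul c d x := Subtype.ext (mul_add _ _ _)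
  zero_smul x := Subtype.ext (mul_zero _)

/-- `eA` is a left module over the ring `eAe`. -/
instance cornerLeftModule {e : A} (he : IsIdempotentElem e) :
    Module he.Corner (groupEA e) where
  smul c x := ⟨c.1 * x.1, c.1 * x.1, by
    have h := ((Subsemigroup.mem_corner_iff he).mp c.2).1
    change e * (c.1 * x.1) = _
    rw [← mul_assoc, h]⟩
  one_smul x := by
    obtain ⟨_, a, rfl⟩ := x
    refine Subtype.ext ?_
    change e * (e * a) = e * a
    rw [← mul_assoc, he.eq]
  mul_smul c d x := Subtype.ext (mul_assoc c.1 d.1 x.1)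
  smul_zero c := Subtype.ext (mul_zero _)
  smul_add c x y := Subtype.ext (mul_add _ _ _)
  add_smul c d x := Subtype.ext (add_mul _ _ _)
  zero_smul x := Subtype.ext (zero_mul _)

/-- The multiplication map `Ae ⊗_{eAe} eA → AeA`. -/
def cornerMul {e : A} (he : IsIdempotentElem e) :
    BTensor he.Corner (groupAe e) (groupEA e) →+ idealAeA e :=
  BTensor.lift he.Corner
    (AddMonoidHom.mk'
      (fun x : groupAe e => AddMonoidHom.mk'
        (fun y : groupEA e => (⟨x.1 * y.1, by
          obtain ⟨_, a, rfl⟩ := x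
          obtain ⟨_, b, rfl⟩ := y
          refine Ideal.subset_span ⟨(a, e * b), ?_⟩
          simp [mul_assoc]⟩ : idealAeA e))
        (fun y z => Subtype.ext (mul_add _ _ _)))
      (fun x y => AddMonoidHom.ext fun z => Subtype.ext (add_mul _ _ _)))
    (fun x c y => Subtype.ext (mul_assoc x.1 c.1 y.1))

/-- `AeA` is a stratifying ideal (Cline, Parshall, Scott): the multiplication map
`Ae ⊗_{eAe} eA → AeA` is an isomorphism and `Tor_n^{eAe}(Ae, eA) = 0` for all `n ≥ 1`. -/
def IsStratifyingIdeal {e : A} (he : IsIdempotentElem e) : Prop :=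
  Function.Bijective (cornerMul he) ∧
    ∀ n : ℕ, 1 ≤ n → Limits.IsZero
      (torGroup he.Corner n (ModuleCat.of (he.Corner)ᵐᵒᵖ (groupAe e))
        (ModuleCat.of he.Corner (groupEA e)))

end Conditions

end

/-! Write `I = AeA`. All four conditions are compared through vanishing of `Tor^A_n(A/I, A/I)` for
`n ≥ 1`: the multiplication half of condition 3 is automatic for a quotient ring
(`epiMul_mk_bijective`).

Relative and absolute Tor. Every module over the semisimple ring `S` is projective, so each module
`A ⊗_S X ⊗_A M` is projective over `A`. The bar complex tensored with `M` is contracted by `x ↦ 1 ⊗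
x`, hence it is a projective resolution of `M`, and relative Tor is Tor (`isZero_relTor_iff`).

Ext and Tor. By dimension shifting, `I` is strong idempotent iff `Ext^i_A(A/I, Y) = 0` for `i ≥ 1`
and all finitely generated `A/I`-modules `Y` (`isStrongIdempotentIdeal_iff`). For `0 → K → P → M →
0` with `P` projective, `Tor_1(A/I, M) = 0` means `K ∩ IP = IK`, that is, `K/IK → P/IP` is
injective. If moreover `M/IM` is projective over `A/I`, this injection splits, so maps `K → Y`
extend to `P`, and `K/IK` is again projective, which permits induction. Conversely, extending `K →
K/IK` to `P` forces `K ∩ IP = IK`; the Noetherian hypothesis makes `K/IK` finitely generated.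

`A` and `eAe`. The counit `Ae ⊗_{eAe} eM → M` has image `IM`. If `M = IM`, cover `M` by a sum `P` of
copies of `Ae`, with kernel `K`. The counit of `P` is bijective, `P = IP`, and `eP` is projective
over `eAe`. Then `Tor_1^A(A/I, M) = 0` iff `K = IK` iff the counit of `M` is injective, while
`Tor_1^{eAe}(Ae, eM) = 0` iff the counit of `K` is injective. Iterating on `K` relates all higher
groups; the case `M = I`, where `eI = eA`, gives condition 4
(`isHomologicalEpi_iff_isStratifyingIdeal`). -/

noncomputable section

/-! ### Dimension shifting for left derived functors -/

/-- An exact complex of projectives augmented over `Z` is a projective resolution of `Z`. -/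
def projectiveResolutionOfExact {C : Type*} [Category* C] [Abelian C] {Z : C}
    (K : ChainComplex C ℕ) (hK : ∀ n, Projective (K.X n)) (ε : K.X 0 ⟶ Z) (hε : Epi ε)
    (w : K.d 1 0 ≫ ε = 0) (h₀ : (ShortComplex.mk _ _ w).Exact)
    (hs : ∀ n, K.ExactAt (n + 1)) : ProjectiveResolution Z where
  complex := K
  projective := hK
  π := (ChainComplex.toSingle₀Equiv _ _).symm ⟨ε, w⟩
  quasiIso := ⟨fun n => by
    cases n
    · rw [ChainComplex.quasiIsoAt₀_iff, ShortComplex.quasiIso_iff_of_zeros']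
      · have h : (ShortComplex.mk (K.d 1 0) ε w).Exact ∧ Epi (ShortComplex.mk (K.d 1 0) ε w).g :=
          ⟨h₀, hε⟩
        have hτ := ChainComplex.toSingle₀Equiv_symm_apply_f_zero ε w
        refine (ShortComplex.exact_and_epi_g_iff_of_iso (ShortComplex.isoMk (Iso.refl (K.X 1))
          (Iso.refl (K.X 0)) (Iso.refl Z) ?_ ?_)).2 h
        · exact (Category.id_comp (K.d 1 0)).trans (Category.comp_id (K.d 1 0)).symm
        · exact (Category.id_comp ε).trans (hτ.symm.trans (Category.comp_id _).symm)
      · exact K.shape _ _ (by simp)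
      all_goals rfl
    · rw [quasiIsoAt_iff_exactAt']
      · apply hs
      · apply ChainComplex.exactAt_succ_single_obj⟩

section DimensionShift

variable {C : Type*} [Category* C] [Abelian C]

/-- The augmentation of a projective resolution. -/
def resolutionAugmentation {Z : C} (Q : ProjectiveResolution Z) : Q.complex.X 0 ⟶ Z :=
  (ChainComplex.toSingle₀Equiv _ _ Q.π).1

lemma d_comp_resolutionAugmentation {Z : C} (Q : ProjectiveResolution Z) :
    Q.complex.d 1 0 ≫ resolutionAugmentation Q = 0 :=
  (ChainComplex.toSingle₀Equiv _ _ Q.π).2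

instance {Z : C} (Q : ProjectiveResolution Z) : Epi (resolutionAugmentation Q) :=
  inferInstanceAs (Epi (Q.π.f 0))

lemma exact_resolutionAugmentation {Z : C} (Q : ProjectiveResolution Z) :
    (ShortComplex.mk _ _ (d_comp_resolutionAugmentation Q)).Exact :=
  Q.exact₀

variable {S : ShortComplex C}

lemma d_comp_splice (Q : ProjectiveResolution S.X₁) :
    Q.complex.d 1 0 ≫ resolutionAugmentation Q ≫ S.f = 0 := by
  rw [← Category.assoc, d_comp_resolutionAugmentation, Limits.zero_comp]

/-- Splicing a short exact sequence with projective middle term and a projective resolution of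
its left term. -/
def spliceResolution (hS : S.ShortExact) [Projective S.X₂] (Q : ProjectiveResolution S.X₁) :
    ProjectiveResolution S.X₃ :=
  have := hS.mono_f
  projectiveResolutionOfExact
    (Q.complex.augment (resolutionAugmentation Q ≫ S.f) (d_comp_splice Q))
    (fun n => match n with
      | 0 => inferInstanceAs (Projective S.X₂)
      | n + 1 => inferInstanceAs (Projective (Q.complex.X n)))
    S.g hS.epi_g
    (by
      change (resolutionAugmentation Q ≫ S.f) ≫ S.g = 0
      rw [Category.assoc, S.zero, Limits.comp_zero])
    (by
      -- The augmentation is epi, so composing with it leaves the image of `S.f` unchanged.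
      let φ : ShortComplex.mk (resolutionAugmentation Q ≫ S.f) S.g
          (by rw [Category.assoc, S.zero, Limits.comp_zero]) ⟶ S :=
        { τ₁ := resolutionAugmentation Q, τ₂ := 𝟙 _, τ₃ := 𝟙 _ }
      have : Epi φ.τ₁ := inferInstanceAs (Epi (resolutionAugmentation Q))
      have : IsIso φ.τ₂ := inferInstanceAs (IsIso (𝟙 S.X₂))
      have : Mono φ.τ₃ := inferInstanceAs (Mono (𝟙 S.X₃))
      exact (ShortComplex.exact_iff_of_epi_of_isIso_of_mono φ).2 hS.exact)
    (fun n => by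
      rw [HomologicalComplex.exactAt_iff' _ (n + 2) (n + 1) n (by simp) (by simp)]
      match n with
      | 0 =>
        -- Following the augmentation by the mono `S.f` does not change its kernel.
        let φ : ShortComplex.mk _ _ (d_comp_resolutionAugmentation Q) ⟶
            ShortComplex.mk _ _ (d_comp_splice Q) :=
          { τ₁ := 𝟙 _, τ₂ := 𝟙 _, τ₃ := S.f }
        have : Epi φ.τ₁ := inferInstanceAs (Epi (𝟙 (Q.complex.X 1)))
        have : IsIso φ.τ₂ := inferInstanceAs (IsIso (𝟙 (Q.complex.X 0)))
        have : Mono φ.τ₃ := inferInstanceAs (Mono S.f)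
        exact (ShortComplex.exact_iff_of_epi_of_isIso_of_mono φ).1 (exact_resolutionAugmentation Q)
      | n + 1 => exact Q.exact_succ n)

variable {D : Type*} [Category* D] [Abelian D] [HasProjectiveResolutions C]
  (F : C ⥤ D) [F.Additive]

lemma isZero_leftDerived_iff {Z : C} (Q : ProjectiveResolution Z) (n : ℕ) :
    Limits.IsZero ((F.leftDerived (n + 1)).obj Z) ↔
      (ShortComplex.mk (F.map (Q.complex.d (n + 2) (n + 1))) (F.map (Q.complex.d (n + 1) n))
        (by rw [← F.map_comp, Q.complex.d_comp_d, F.map_zero])).Exact := by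
  rw [(Q.isoLeftDerivedObj F (n + 1)).isZero_iff]
  exact (HomologicalComplex.exactAt_iff_isZero_homology _ _).symm.trans
    (HomologicalComplex.exactAt_iff' _ (n + 2) (n + 1) n (by simp) (by simp))

lemma isZero_leftDerived_add_two_iff (hS : S.ShortExact) [Projective S.X₂] (n : ℕ) :
    Limits.IsZero ((F.leftDerived (n + 2)).obj S.X₃) ↔
      Limits.IsZero ((F.leftDerived (n + 1)).obj S.X₁) := by
  let Q := projectiveResolution S.X₁
  rw [isZero_leftDerived_iff F Q, isZero_leftDerived_iff F (spliceResolution hS Q)]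
  -- The spliced complex is `Q` moved up one degree, so in these degrees the two exactness
  -- statements agree by definition.
  exact Iff.rfl

/-- `F` keeps `Q₁ → Q₀ → X₁ → 0` exact, so exactness of `F Q₁ → F Q₀ → F X₂` says that passing from
`F X₁` to `F X₂` enlarges no kernel. -/
lemma isZero_leftDerived_one_iff (hS : S.ShortExact) [Projective S.X₂]
    [Limits.PreservesFiniteColimits F] :
    Limits.IsZero ((F.leftDerived 1).obj S.X₃) ↔ Mono (F.map S.f) := by
  let Q := projectiveResolution S.X₁
  rw [isZero_leftDerived_iff F (spliceResolution hS Q)]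
  let ε := resolutionAugmentation Q
  have hQ := (exact_resolutionAugmentation Q).map_of_epi_of_preservesCokernel F
    (inferInstanceAs (Epi ε)) inferInstance
  have hε : Epi (F.map ε) := inferInstance
  have h : F.map (Q.complex.d 1 0) ≫ F.map ε = 0 := by
    rw [← F.map_comp, d_comp_resolutionAugmentation, F.map_zero]
  change (ShortComplex.mk (F.map (Q.complex.d 1 0)) (F.map (ε ≫ S.f))
    (by rw [← F.map_comp, d_comp_splice, F.map_zero])).Exact ↔ _
  let φ : ShortComplex.mk (F.map (Q.complex.d 1 0)) (F.map ε) h ⟶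
      ShortComplex.mk (F.map (Q.complex.d 1 0)) (F.map (ε ≫ S.f))
        (by rw [← F.map_comp, d_comp_splice, F.map_zero]) :=
    { τ₁ := 𝟙 _, τ₂ := 𝟙 _, τ₃ := F.map S.f }
  have h₁ : Epi φ.τ₁ := inferInstanceAs (Epi (𝟙 (F.obj (Q.complex.X 1))))
  have h₂ : IsIso φ.τ₂ := inferInstanceAs (IsIso (𝟙 (F.obj (Q.complex.X 0))))
  constructor
  · intro hex
    -- Diagram chase: after refinement `g` lifts to `F Q₀`, the lift dies in `F X₂` and so comes
    -- from `F Q₁`, which the augmentation kills.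
    refine Preadditive.mono_of_cancel_zero _ fun {T} g hg => ?_
    obtain ⟨T', p, _, a, ha⟩ := surjective_up_to_refinements_of_epi (F.map ε) g
    obtain ⟨T'', p', _, b, hb⟩ := hex.exact_up_to_refinements a (by
      change a ≫ F.map (ε ≫ S.f) = 0
      rw [F.map_comp, ← Category.assoc, ← ha, Category.assoc, hg, Limits.comp_zero])
    rw [← cancel_epi p, ← cancel_epi p', ha, Limits.comp_zero, Limits.comp_zero, ← Category.assoc,
      hb, Category.assoc]
    exact (congrArg (b ≫ ·) h).trans Limits.comp_zero
  · intro hm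
    have : Mono φ.τ₃ := hm
    exact (ShortComplex.exact_iff_of_epi_of_isIso_of_mono φ).1 hQ
end DimensionShift

/-! ### Right exactness of the tensor product -/

namespace BTensor

variable {R : Type*} [Ring R] {N : Type*} [AddCommGroup N] [Module Rᵐᵒᵖ N]
  {M : Type*} [AddCommGroup M] [Module R M]

variable (R) in
lemma tmul_zero (n : N) : tmul R n (0 : M) = 0 := by
  simpa using tmul_add R n (0 : M) 0

variable (R) in
lemma zero_tmul (m : M) : tmul R (0 : N) m = 0 := by
  simpa using add_tmul R (0 : N) 0 m

variable (R) in
lemma tmul_sub (n : N) (m m' : M) : tmul R n (m - m') = tmul R n m - tmul R n m' := by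
  rw [eq_sub_iff_add_eq, ← tmul_add, sub_add_cancel]

variable {M₁ M₂ M₃ : Type*} [AddCommGroup M₁] [Module R M₁] [AddCommGroup M₂] [Module R M₂]
  [AddCommGroup M₃] [Module R M₃]

variable (N) in
lemma map_surjective {g : M₂ →ₗ[R] M₃} (hg : Function.Surjective g) :
    Function.Surjective (map (LinearMap.id : N →ₗ[Rᵐᵒᵖ] N) g) := by
  intro x
  induction x using induction_on with
  | zero => exact ⟨0, map_zero _⟩
  | tmul n m =>
    obtain ⟨m, rfl⟩ := hg m
    exact ⟨tmul R n m, map_tmul _ _ n m⟩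
  | add x y hx hy =>
    obtain ⟨x, rfl⟩ := hx
    obtain ⟨y, rfl⟩ := hy
    exact ⟨x + y, map_add _ x y⟩

variable (N) in
-- An inverse of the map from the cokernel of `N ⊗ f` to `N ⊗ M₃` is built by choosing preimages
-- under `g`; exactness at `M₂` makes the choice irrelevant modulo the range.
lemma map_exact {f : M₁ →ₗ[R] M₂} {g : M₂ →ₗ[R] M₃} (h : Function.Exact f g)
    (hg : Function.Surjective g) :
    Function.Exact (map (LinearMap.id : N →ₗ[Rᵐᵒᵖ] N) f)
      (map (LinearMap.id : N →ₗ[Rᵐᵒᵖ] N) g) := by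
  let I := (map (LinearMap.id : N →ₗ[Rᵐᵒᵖ] N) f).range
  let q : BTensor R N M₂ →+ BTensor R N M₂ ⧸ I := QuotientAddGroup.mk' I
  have key (n : N) (x y : M₂) (hxy : g x = g y) : q (tmul R n x) = q (tmul R n y) := by
    rw [← sub_eq_zero, ← map_sub, ← tmul_sub]
    obtain ⟨z, hz⟩ := (h (x - y)).1 (by rw [map_sub, hxy, sub_self])
    refine (QuotientAddGroup.eq_zero_iff _).2 ⟨tmul R n z, ?_⟩
    rw [map_tmul, hz, LinearMap.id_apply]
  -- A set-theoretic section suffices: `key` makes `q (n ⊗ s m)` additive and balanced although `s`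
  -- need not be linear.
  let s := Function.surjInv hg
  have hs := Function.surjInv_eq hg
  let r : BTensor R N M₃ →+ BTensor R N M₂ ⧸ I :=
    lift R (AddMonoidHom.mk' (fun n => AddMonoidHom.mk' (fun m => q (tmul R n (s m)))
        (fun m m' => by
          rw [← map_add, ← tmul_add]
          exact key _ _ _ (by rw [map_add, hs, hs, hs])))
        (fun n n' => by
          ext m
          change q (tmul R (n + n') (s m)) = q (tmul R n (s m)) + q (tmul R n' (s m))
          rw [add_tmul, map_add]))
      (fun n a m => by
        change q (tmul R (op a • n) (s m)) = q (tmul R n (s (a • m)))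
        rw [smul_tmul]
        exact key _ _ _ (by rw [map_smul, hs, hs]))
  have hr : r.comp (map (LinearMap.id : N →ₗ[Rᵐᵒᵖ] N) g) = q := by
    refine addHom_ext fun n m => ?_
    rw [AddMonoidHom.comp_apply, map_tmul]
    exact key _ _ _ (hs _)
  intro x
  constructor
  · intro hx
    have : q x = 0 := by rw [← hr, AddMonoidHom.comp_apply, hx, map_zero]
    exact (QuotientAddGroup.eq_zero_iff x).1 this
  · rintro ⟨x, rfl⟩
    rw [← AddMonoidHom.comp_apply, ← map_comp]
    have : g ∘ₗ f = 0 := LinearMap.ext h.apply_apply_eq_zero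
    rw [this, map_zero_right, AddMonoidHom.zero_apply]

end BTensor

instance {R : Type u} [Ring R] (N : ModuleCat.{u} Rᵐᵒᵖ) :
    Limits.PreservesFiniteColimits (tensorFunctor N) := by
  refine ((tensorFunctor N).preservesFiniteColimits_tfae.out 0 3 :
    (∀ S : ShortComplex (ModuleCat.{u} R), S.ShortExact →
      (S.map (tensorFunctor N)).Exact ∧ Epi ((tensorFunctor N).map S.g)) ↔ _).1
    fun S hS => ⟨?_, ?_⟩
  · rw [ShortComplex.ab_exact_iff_function_exact]
    exact BTensor.map_exact N
      ((ShortComplex.ShortExact.moduleCat_exact_iff_function_exact S).1 hS.exact)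
      hS.moduleCat_surjective_g
  · rw [AddCommGrpCat.epi_iff_surjective]
    exact BTensor.map_surjective N hS.moduleCat_surjective_g

/-! ### Dimension shifting for Tor along a short exact sequence with projective middle term. -/

section TorShift

variable {R : Type u} [Ring R] {K P M : Type u} [AddCommGroup K] [Module R K]
  [AddCommGroup P] [Module R P] [AddCommGroup M] [Module R M]
  {f : K →ₗ[R] P} {g : P →ₗ[R] M}

lemma linearMap_shortExact (hf : Function.Injective f) (h : Function.Exact f g)
    (hg : Function.Surjective g) :
    (ShortComplex.mk (ModuleCat.ofHom f) (ModuleCat.ofHom g)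
      (by ext x; exact h.apply_apply_eq_zero x)).ShortExact :=
  ModuleCat.shortComplex_shortExact _ h hf hg

variable [Module.Projective R P]

instance : Projective (ModuleCat.of R P) :=
  (IsProjective.iff_projective P).1 inferInstance

lemma isZero_torGroup_add_two_iff (N : ModuleCat.{u} Rᵐᵒᵖ) (hf : Function.Injective f)
    (h : Function.Exact f g) (hg : Function.Surjective g) (n : ℕ) :
    Limits.IsZero (torGroup R (n + 2) N (ModuleCat.of R M)) ↔
      Limits.IsZero (torGroup R (n + 1) N (ModuleCat.of R K)) := by
  exact isZero_leftDerived_add_two_iff (tensorFunctor N) (linearMap_shortExact hf h hg) n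

lemma isZero_torGroup_one_iff (N : ModuleCat.{u} Rᵐᵒᵖ) (hf : Function.Injective f)
    (h : Function.Exact f g) (hg : Function.Surjective g) :
    Limits.IsZero (torGroup R 1 N (ModuleCat.of R M)) ↔
      Function.Injective (BTensor.map (LinearMap.id : N →ₗ[Rᵐᵒᵖ] N) f) := by
  refine (isZero_leftDerived_one_iff (tensorFunctor N) (linearMap_shortExact hf h hg)).trans ?_
  rw [AddCommGrpCat.mono_iff_injective]
  exact Iff.rfl

end TorShift

/-! ### The relative bar resolution over a semisimple subring -/

section BarResolution

variable {A : Type u} [Ring A] (S : Subring A)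

/-- The inclusion `x ↦ 1 ⊗ x` of `X` into `A ⊗_S X`, as a homomorphism of right modules. -/
def IndTensor.unit (X : BimoduleObj A A) :
    X.carrier →ₗ[Aᵐᵒᵖ] (inducedBimodule S X).carrier where
  toFun x := IndTensor.tmul S 1 x
  map_add' x y := BTensor.tmul_add S 1 x y
  map_smul' b x := (IndTensor.op_smul_tmul S b 1 x).symm

/-! ### Projectivity of the terms of the bar resolution. -/

section Projective

variable (X : BimoduleObj A A) (M : Type u) [AddCommGroup M] [Module A M]

/-- The map `A ⊗_S X ⊗_A M → Y`, `a ⊗ x ⊗ m ↦ a j(x ⊗ m)`, induced by an `S`-linear map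
`j : X ⊗_A M → Y`. -/
def inducedLift {Y : Type u} [AddCommGroup Y] [Module A Y]
    (j : BTensor A X.carrier M →ₗ[S] Y) :
    BTensor A (inducedBimodule S X).carrier M →ₗ[A] Y :=
  let p (m : M) : IndTensor S X.carrier →+ Y :=
    BTensor.lift (N := A) (M := X.carrier) S
      (AddMonoidHom.mk' (fun a => AddMonoidHom.mk' (fun x => a • j (BTensor.tmul A x m))
          (fun x y => by rw [BTensor.add_tmul, map_add, smul_add]))
        (fun a b => by ext x; exact add_smul a b _))
      (fun a s x => by
        change (a * (s : A)) • j (BTensor.tmul A x m) = a • j (BTensor.tmul A ((s : A) • x) m)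
        rw [mul_smul, ← BTensor.left_smul_tmul]
        exact congrArg (a • ·) (map_smul j s _).symm)
  let q : BTensor A (inducedBimodule S X).carrier M →+ Y :=
    BTensor.lift (N := (inducedBimodule S X).carrier) A
      (AddMonoidHom.flip (AddMonoidHom.mk' p (fun m m' => by
        refine BTensor.addHom_ext fun a x => ?_
        change a • j (BTensor.tmul A x (m + m')) =
          a • j (BTensor.tmul A x m) + a • j (BTensor.tmul A x m')
        rw [BTensor.tmul_add, map_add, smul_add])))
      (fun z r m => by
        have key (z : IndTensor S X.carrier) : p m (op r • z) = p (r • m) z := by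
          induction z using IndTensor.induction_on with
          | zero => rw [smul_zero, map_zero, map_zero]
          | tmul a x =>
            refine (congrArg (p m) (IndTensor.op_smul_tmul S (op r) a x)).trans ?_
            change a • j (BTensor.tmul A (op r • x) m) = a • j (BTensor.tmul A x (r • m))
            rw [BTensor.smul_tmul]
          | add x y hx hy => rw [smul_add, map_add, map_add, hx, hy]
        exact key z)
  { toFun := q
    map_add' := map_add q
    map_smul' := fun a z => by
      induction z using BTensor.induction_on with
      | zero => rw [smul_zero, map_zero, smul_zero]
      | tmul z m =>
        rw [BTensor.left_smul_tmul]
        have key (z : IndTensor S X.carrier) : p m (a • z) = a • p m z := by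
          induction z using IndTensor.induction_on with
          | zero => rw [smul_zero, map_zero, smul_zero]
          | tmul b x =>
            refine (congrArg (p m) (IndTensor.smul_tmul S a b x)).trans ?_
            exact mul_smul a b _
          | add x y hx hy => rw [smul_add, map_add, map_add, hx, hy, smul_add]
        exact key z
      | add x y hx hy => rw [smul_add, map_add, map_add, hx, hy, smul_add] }

lemma inducedLift_tmul {Y : Type u} [AddCommGroup Y] [Module A Y]
    (j : BTensor A X.carrier M →ₗ[S] Y) (a : A) (x : X.carrier) (m : M) :
    inducedLift S X M j (BTensor.tmul (N := (inducedBimodule S X).carrier) A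
      (IndTensor.tmul S a x) m) = a • j (BTensor.tmul A x m) := rfl

lemma inducedBimodule_addHom_ext {Y : Type*} [AddCommGroup Y]
    {f g : BTensor A (inducedBimodule S X).carrier M →+ Y}
    (h : ∀ a x m, f (BTensor.tmul (N := (inducedBimodule S X).carrier) A
        (IndTensor.tmul S a x) m) =
      g (BTensor.tmul (N := (inducedBimodule S X).carrier) A (IndTensor.tmul S a x) m)) :
    f = g := by
  refine BTensor.addHom_ext fun z m => ?_
  change IndTensor S X.carrier at z
  induction z using IndTensor.induction_on with
  | zero =>
    have h0 : BTensor.tmul A (0 : (inducedBimodule S X).carrier) m = 0 := BTensor.zero_tmul A m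
    exact (congrArg f h0).trans ((map_zero f).trans ((map_zero g).symm.trans
      (congrArg g h0.symm)))
  | tmul a x => exact h a x m
  | add x y hx hy =>
    have h0 := BTensor.add_tmul (N := (inducedBimodule S X).carrier) A x y m
    refine (congrArg f h0).trans (Eq.trans ?_ (congrArg g h0).symm)
    rw [map_add, map_add]
    exact congrArg₂ (· + ·) hx hy

/-- The module is induced from the `S`-module `X ⊗_A M`, which is projective because `S` is
semisimple; induction preserves projectivity by the adjunction `inducedLift`. -/
lemma inducedBimodule_projective [IsSemisimpleRing S] :
    Module.Projective A (BTensor A (inducedBimodule S X).carrier M) := by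
  refine Module.Projective.of_lifting_property'' fun f hf => ?_
  -- The unit `x ⊗ m ↦ 1 ⊗ x ⊗ m` of the adjunction. It is lifted through `f` over `S`, and the lift
  -- is then extended `A`-linearly to a section of `f`.
  let j : BTensor A X.carrier M →ₗ[S] BTensor A (inducedBimodule S X).carrier M :=
    { toFun := BTensor.map (IndTensor.unit S X) LinearMap.id
      map_add' := map_add _
      map_smul' := fun s z => by
        induction z using BTensor.induction_on with
        | zero => rw [smul_zero, map_zero, smul_zero]
        | tmul x m =>
          have h : s • BTensor.tmul A x m = BTensor.tmul A ((s : A) • x) m :=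
            BTensor.left_smul_tmul (s : A) x m
          rw [h, BTensor.map_tmul, BTensor.map_tmul]
          refine Eq.trans ?_ (BTensor.left_smul_tmul (s : A) _ _).symm
          congr 1
          refine Eq.trans ?_ (IndTensor.smul_tmul S (s : A) 1 x).symm
          rw [mul_one]
          have h' := BTensor.smul_tmul S s (1 : A) x
          rw [subring_op_smul, one_mul] at h'
          exact h'.symm
        | add x y hx hy => rw [smul_add, map_add, map_add, hx, hy, smul_add] }
  let f' : (BTensor A (inducedBimodule S X).carrier M →₀ A) →ₗ[S]
      BTensor A (inducedBimodule S X).carrier M :=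
    { toFun := f
      map_add' := map_add f
      map_smul' := fun s z => f.map_smul (s : A) z }
  have := Module.projective_of_isSemisimpleRing S (BTensor A X.carrier M)
  obtain ⟨j', hj'⟩ := Module.projective_lifting_property f' j hf
  refine ⟨inducedLift S X M j', LinearMap.toAddMonoidHom_injective ?_⟩
  refine inducedBimodule_addHom_ext S X M fun a x m => ?_
  change f (inducedLift S X M j' _) = _
  rw [inducedLift_tmul, map_smul]
  have h : f (j' (BTensor.tmul A x m)) = j (BTensor.tmul A x m) := LinearMap.congr_fun hj' _
  rw [h]
  refine (BTensor.left_smul_tmul a _ _).trans ?_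
  change BTensor.tmul A (a • IndTensor.tmul S 1 x) m = _
  rw [IndTensor.smul_tmul, mul_one]
  rfl

end Projective

/-! ### The contracting homotopy and the resulting projective resolution. -/

section Homotopy

/-- The map `x ↦ 1 ⊗ x` between consecutive terms of the bar resolution. -/
def barUnit (k : ℕ) : (barObj S k).carrier →ₗ[Aᵐᵒᵖ] (barObj S (k + 1)).carrier :=
  IndTensor.unit S (barObj S k)

lemma barD_zero_unit (x : (barObj S 0).carrier) : (barD S 0).right (barUnit S 0 x) = x :=
  one_smul A x

/-- The homotopy identity `dh + hd = id`, read off from `d (a ⊗ x) = a x - a ⊗ d x` at `a = 1`.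
Right linearity of `h` is what allows it to be tensored with `M`. -/
lemma barD_succ_unit (k : ℕ) (x : (barObj S (k + 1)).carrier) :
    (barD S (k + 1)).right (barUnit S (k + 1) x) = x - barUnit S k ((barD S k).right x) := by
  have h := mul_sub_map_tmul S (X := (barObj S k).carrier) (barD S k).left 1 x
  exact h.trans (congrArg (· - barUnit S k ((barD S k).right x)) (one_smul A x))

variable (M : Type u) [AddCommGroup M] [Module A M]

/-- The differential of `β(A, S, A) ⊗_A M`, including the one into degree `-1`. -/
def barTensorD (k : ℕ) :
    BTensor A (barObj S (k + 1)).carrier M →+ BTensor A (barObj S k).carrier M :=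
  BTensor.map (barD S k).right LinearMap.id

lemma barTensorD_tmul (k : ℕ) (x : (barObj S (k + 1)).carrier) (m : M) :
    barTensorD S M k (BTensor.tmul A x m) = BTensor.tmul A ((barD S k).right x) m := rfl

/-- The contracting homotopy of `β(A, S, A) ⊗_A M`. -/
def barTensorHomotopy (k : ℕ) :
    BTensor A (barObj S k).carrier M →+ BTensor A (barObj S (k + 1)).carrier M :=
  BTensor.map (barUnit S k) LinearMap.id

lemma barTensorHomotopy_tmul (k : ℕ) (x : (barObj S k).carrier) (m : M) :
    barTensorHomotopy S M k (BTensor.tmul A x m) = BTensor.tmul A (barUnit S k x) m := rfl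

lemma barTensorD_zero_homotopy (x : BTensor A (barObj S 0).carrier M) :
    barTensorD S M 0 (barTensorHomotopy S M 0 x) = x := by
  induction x using BTensor.induction_on with
  | zero => rw [map_zero, map_zero]
  | tmul x m => rw [barTensorHomotopy_tmul, barTensorD_tmul, barD_zero_unit]
  | add x y hx hy => rw [map_add, map_add, hx, hy]

lemma barTensorD_homotopy (k : ℕ) (x : BTensor A (barObj S (k + 1)).carrier M) :
    barTensorD S M (k + 1) (barTensorHomotopy S M (k + 1) x) +
      barTensorHomotopy S M k (barTensorD S M k x) = x := by
  induction x using BTensor.induction_on with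
  | zero => simp only [map_zero, add_zero]
  | tmul x m =>
    rw [barTensorHomotopy_tmul, barTensorD_tmul, barTensorD_tmul, barTensorHomotopy_tmul,
      barD_succ_unit, ← BTensor.add_tmul, sub_add_cancel]
  | add x y hx hy =>
    simp only [map_add]
    rw [add_add_add_comm, hx, hy]

lemma barTensorD_comp (k : ℕ) (x : BTensor A (barObj S (k + 2)).carrier M) :
    barTensorD S M k (barTensorD S M (k + 1) x) = 0 := by
  induction x using BTensor.induction_on with
  | zero => simp only [map_zero]
  | tmul x m =>
    have h : (barD S k).right ((barD S (k + 1)).right x) = 0 := barD_comp S k x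
    rw [barTensorD_tmul, barTensorD_tmul, h, BTensor.zero_tmul]
  | add x y hx hy => rw [map_add, map_add, hx, hy, add_zero]

lemma barTensorD_exact (k : ℕ) :
    Function.Exact (barTensorD S M (k + 1)) (barTensorD S M k) := by
  intro x
  constructor
  · intro hx
    refine ⟨barTensorHomotopy S M (k + 1) x, ?_⟩
    have h := barTensorD_homotopy S M k x
    rwa [hx, map_zero, add_zero] at h
  · rintro ⟨x, rfl⟩
    exact barTensorD_comp S M k x

/-- The isomorphism `A ⊗_A M → M`. -/
def barAugmentation : BTensor A (barObj S 0).carrier M →+ M :=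
  BTensor.lift (N := A) A
    (AddMonoidHom.mk' (fun a : A => DistribSMul.toAddMonoidHom M a)
      (fun a b => AddMonoidHom.ext fun x => add_smul a b x))
    (fun a r m => mul_smul a r m)

/-- The map `m ↦ 1 ⊗ m` is the inverse, since `a ⊗ m = 1 ⊗ a m`. -/
lemma barAugmentation_bijective : Function.Bijective (barAugmentation S M) := by
  let one : (barObj S 0).carrier := (1 : A)
  have key (x : BTensor A (barObj S 0).carrier M) :
      BTensor.tmul A one (barAugmentation S M x) = x := by
    induction x using BTensor.induction_on with
    | zero => rw [map_zero, BTensor.tmul_zero]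
    | tmul a m =>
      change A at a
      have h := BTensor.smul_tmul (N := A) A a (1 : A) m
      rw [op_smul_eq_mul, one_mul] at h
      exact h.symm
    | add x y hx hy => rw [map_add, BTensor.tmul_add, hx, hy]
  exact ⟨Function.LeftInverse.injective key, fun m => ⟨BTensor.tmul A one m, one_smul A m⟩⟩

/-- The augmentation `a ⊗ b ⊗ m ↦ a b m` of `β(A, S, A) ⊗_A M`. -/
def barTensorAugmentation : BTensor A (barObj S 1).carrier M →ₗ[A] M where
  toFun x := barAugmentation S M (barTensorD S M 0 x)
  map_add' x y := by rw [map_add, map_add]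
  map_smul' a x := by
    have h := map_smul ((barD S 0).tensorRight M) a x
    refine (congrArg (barAugmentation S M) h).trans ?_
    change barAugmentation S M (a • barTensorD S M 0 x) = _
    generalize barTensorD S M 0 x = y
    induction y using BTensor.induction_on with
    | zero => simp only [smul_zero, map_zero]
    | tmul b m =>
      rw [BTensor.left_smul_tmul]
      exact mul_smul (a : A) (b : A) m
    | add x y hx hy => rw [smul_add, map_add, map_add, smul_add, hx, hy]

lemma barTensor_d (M : ModuleCat.{u} A) (k : ℕ) :
    (barTensor S M).d (k + 1) k = ModuleCat.ofHom ((barD S (k + 1)).tensorRight M) :=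
  ChainComplex.of_d (fun k => ModuleCat.of A (BTensor A (barObj S (k + 1)).carrier M))
    (fun k => ModuleCat.ofHom ((barD S (k + 1)).tensorRight M)) k

/-- The relative bar resolution over a semisimple subring. -/
def barResolution [IsSemisimpleRing S] (M : ModuleCat.{u} A) : ProjectiveResolution M :=
  projectiveResolutionOfExact (barTensor S M)
    (fun n => by
      have := inducedBimodule_projective S (barObj S n) M
      exact inferInstanceAs (Projective (ModuleCat.of A
        (BTensor A (inducedBimodule S (barObj S n)).carrier M))))
    (ModuleCat.ofHom (barTensorAugmentation S M))
    ((ModuleCat.epi_iff_surjective _).2 fun m => by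
      obtain ⟨x, hx⟩ := (barAugmentation_bijective S M).2 m
      refine ⟨barTensorHomotopy S M 0 x, ?_⟩
      change barAugmentation S M (barTensorD S M 0 (barTensorHomotopy S M 0 x)) = m
      rw [barTensorD_zero_homotopy, hx])
    (by
      rw [barTensor_d]
      ext x
      refine (congrArg (barAugmentation S M) (barTensorD_comp S M 0 x)).trans (map_zero _))
    (by
      rw [ShortComplex.ShortExact.moduleCat_exact_iff_function_exact]
      simp only [barTensor_d]
      intro x
      refine Iff.trans ?_ (barTensorD_exact S M 0 x)
      -- The augmentation to `M` differs from the differential into `A ⊗_A M` only by the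
      -- isomorphism `A ⊗_A M ≅ M`, so the two have the same kernel.
      exact map_eq_zero_iff (barAugmentation S M) (barAugmentation_bijective S M).1)
    (fun n => by
      rw [HomologicalComplex.exactAt_iff' _ (n + 2) (n + 1) n (by simp) (by simp),
        ShortComplex.ShortExact.moduleCat_exact_iff_function_exact]
      change Function.Exact ((barTensor S M).d (n + 2) (n + 1)) ((barTensor S M).d (n + 1) n)
      rw [barTensor_d, barTensor_d]
      exact barTensorD_exact S M (n + 1))

lemma isZero_relTor_iff [IsSemisimpleRing S] (n : ℕ) (N : ModuleCat.{u} Aᵐᵒᵖ)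
    (M : ModuleCat.{u} A) :
    Limits.IsZero (relTor S n N M) ↔ Limits.IsZero (torGroup A n N M) :=
  (((barResolution S M).isoLeftDerivedObj (tensorFunctor N) n).isZero_iff).symm

end Homotopy

end BarResolution

/-! ### Dimension shifting for Ext -/

section ExtShift

open Abelian

variable {C : Type*} [Category* C] [Abelian C] [HasExt.{u} C] {S : ShortComplex C}

/-- From the exact sequence `Hom(X₂, Y) → Hom(X₁, Y) → Ext¹(X₃, Y) → Ext¹(X₂, Y) = 0`. -/
lemma subsingleton_ext_one_iff (hS : S.ShortExact) [Projective S.X₂] (Y : C) :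
    Subsingleton (Ext.{u} S.X₃ Y 1) ↔ ∀ a : S.X₁ ⟶ Y, ∃ b : S.X₂ ⟶ Y, S.f ≫ b = a := by
  constructor
  · intro h a
    obtain ⟨x, hx⟩ := Ext.contravariant_sequence_exact₁ hS Y (Ext.mk₀ a) (add_zero 1)
      (Subsingleton.elim _ _)
    obtain ⟨b, rfl⟩ := (Ext.mk₀_bijective _ _).2 x
    rw [Ext.mk₀_comp_mk₀] at hx
    exact ⟨b, (Ext.mk₀_bijective _ _).1 hx⟩
  · intro h
    refine subsingleton_of_forall_eq 0 fun x => ?_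
    obtain ⟨y, rfl⟩ := Ext.contravariant_sequence_exact₃ hS Y x (Ext.eq_zero_of_projective _)
      (add_zero 1)
    obtain ⟨a, rfl⟩ := (Ext.mk₀_bijective _ _).2 y
    obtain ⟨b, rfl⟩ := h a
    rw [← Ext.mk₀_comp_mk₀, hS.extClass_comp_assoc]

lemma subsingleton_ext_add_two_iff (hS : S.ShortExact) [Projective S.X₂] (Y : C) (n : ℕ) :
    Subsingleton (Ext.{u} S.X₃ Y (n + 2)) ↔ Subsingleton (Ext.{u} S.X₁ Y (n + 1)) := by
  constructor
  · intro h
    refine subsingleton_of_forall_eq 0 fun x => ?_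
    obtain ⟨y, rfl⟩ := Ext.contravariant_sequence_exact₁ hS Y x (by omega : _ = n + 2)
      (Subsingleton.elim _ _)
    rw [Ext.eq_zero_of_projective y, Ext.comp_zero]
  · intro h
    refine subsingleton_of_forall_eq 0 fun x => ?_
    obtain ⟨y, rfl⟩ := Ext.contravariant_sequence_exact₃ hS Y x (Ext.eq_zero_of_projective _)
      (by omega : 1 + (n + 1) = n + 2)
    rw [Subsingleton.elim y 0, Ext.comp_zero]

open Limits in
-- Both rows `Extⁿ(X₂, Y) → Extⁿ(X₁, Y) → Extⁿ⁺¹(X₃, Y) → 0` are exact because the next term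
-- vanishes, and the comparison maps commute with composition by `S.f` and by the extension class;
-- the four lemmas then apply.
lemma mapExtAddHom_bijective_succ {D : Type*} [Category* D] [Abelian D] [HasExt.{u} D]
    (F : C ⥤ D) [F.Additive] [PreservesFiniteLimits F] [PreservesFiniteColimits F]
    (hS : S.ShortExact) (Y : C) (n : ℕ) (h₁ : Subsingleton (Ext.{u} S.X₂ Y (n + 1)))
    (h₂ : Subsingleton (Ext.{u} (F.obj S.X₂) (F.obj Y) (n + 1)))
    (hsurj : Function.Surjective (F.mapExtAddHom S.X₂ Y n))
    (hbij : Function.Bijective (F.mapExtAddHom S.X₁ Y n)) :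
    Function.Bijective (F.mapExtAddHom S.X₃ Y (n + 1)) := by
  have := hS.mono_f
  have := hS.epi_g
  have hSF := hS.map F
  exact AddMonoidHom.bijective_of_surjective_of_bijective_of_right_exact _ _ _ _
    (F.mapExtAddHom S.X₂ Y n) (F.mapExtAddHom S.X₁ Y n) (F.mapExtAddHom S.X₃ Y (n + 1))
    (AddMonoidHom.ext fun x => by simp [Ext.mapExactFunctor_comp, Ext.mapExactFunctor_mk₀]; rfl)
    (AddMonoidHom.ext fun x => by
      simp [Ext.mapExactFunctor_comp, Ext.mapExactFunctor_extClass]; rfl)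
    ((ShortComplex.ab_exact_iff_function_exact _).1
      (Ext.contravariant_sequence_exact₁' hS Y n (n + 1) (add_comm 1 n)))
    ((ShortComplex.ab_exact_iff_function_exact _).1
      (Ext.contravariant_sequence_exact₁' hSF (F.obj Y) n (n + 1) (add_comm 1 n)))
    hsurj hbij
    (fun x => Ext.contravariant_sequence_exact₃ hS _ x (Subsingleton.elim _ _) (add_comm 1 n))
    (fun x => Ext.contravariant_sequence_exact₃ hSF _ x (h₂.elim _ _) (add_comm 1 n))

end ExtShift

/-! ### Tensoring with the quotient by a two-sided ideal -/

section QuotientTensor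

variable {A : Type u} [Ring A] (I : Ideal A) [I.IsTwoSided]
  {M : Type u} [AddCommGroup M] [Module A M]

/-- The element `1 ⊗ m` of `A/I ⊗_A M`. -/
def quotientTmul (m : M) : BTensor A (rightVia (Ideal.Quotient.mk I)) M :=
  BTensor.tmul A (show rightVia (Ideal.Quotient.mk I) from (1 : A ⧸ I)) m

lemma mk_tmul (a : A) (m : M) :
    BTensor.tmul A (show rightVia (Ideal.Quotient.mk I) from Ideal.Quotient.mk I a) m =
      quotientTmul I (a • m) := by
  rw [quotientTmul, ← BTensor.smul_tmul]
  congr 1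
  exact (one_mul (Ideal.Quotient.mk I a)).symm

lemma quotientTmul_surjective : Function.Surjective (quotientTmul I (M := M)) := by
  intro x
  induction x using BTensor.induction_on with
  | zero => exact ⟨0, BTensor.tmul_zero A _⟩
  | tmul b m =>
    obtain ⟨a, rfl⟩ := Ideal.Quotient.mk_surjective (I := I) b
    exact ⟨a • m, (mk_tmul I a m).symm⟩
  | add x y hx hy =>
    obtain ⟨x, rfl⟩ := hx
    obtain ⟨y, rfl⟩ := hy
    exact ⟨x + y, BTensor.tmul_add A _ x y⟩

/-- The map `A/I ⊗_A M → M/IM`. -/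
def quotientTensorMap : BTensor A (rightVia (Ideal.Quotient.mk I)) M →+
    M ⧸ (I • ⊤ : Submodule A M) :=
  BTensor.lift (N := rightVia (Ideal.Quotient.mk I)) A
    (AddMonoidHom.mk' (fun b : A ⧸ I => (DistribSMul.toAddMonoidHom
        (M ⧸ (I • ⊤ : Submodule A M)) b).comp (Submodule.mkQ _).toAddMonoidHom)
      (fun b c => AddMonoidHom.ext fun m => add_smul (R := A ⧸ I) b c _))
    (fun b a m => by
      obtain ⟨b, rfl⟩ := Ideal.Quotient.mk_surjective (I := I) b
      change Submodule.Quotient.mk ((b * a) • m) = Submodule.Quotient.mk (b • a • m)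
      rw [mul_smul])

/-- Together with `quotientTmul_surjective` this is the isomorphism `A/I ⊗_A M ≅ M/IM`. -/
lemma quotientTmul_eq_zero_iff (m : M) :
    quotientTmul I m = 0 ↔ m ∈ (I • ⊤ : Submodule A M) := by
  constructor
  · intro h
    have h' : quotientTensorMap I (quotientTmul I m) = Submodule.Quotient.mk m :=
      one_smul (A ⧸ I) (Submodule.Quotient.mk m : M ⧸ (I • ⊤ : Submodule A M))
    rw [h, map_zero] at h'
    exact (Submodule.Quotient.mk_eq_zero _).1 h'.symm
  · intro h
    refine Submodule.smul_induction_on h (fun a ha m _ => ?_) (fun x y hx hy => ?_)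
    · rw [← mk_tmul, Ideal.Quotient.eq_zero_iff_mem.2 ha]
      exact BTensor.zero_tmul A m
    · exact (BTensor.tmul_add A _ x y).trans (by
        change quotientTmul I x + quotientTmul I y = 0
        rw [hx, hy, add_zero])

/-- For the inclusion of a syzygy `K` in `P` the criterion reads `K ∩ IP ⊆ IK`; in this form
vanishing of `Tor_1(A/I, -)` is used below. -/
lemma quotientTensor_map_injective_iff {K : Type u} [AddCommGroup K] [Module A K]
    (f : K →ₗ[A] M) :
    Function.Injective (BTensor.map (LinearMap.id : rightVia (Ideal.Quotient.mk I) →ₗ[Aᵐᵒᵖ] _) f) ↔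
      ∀ k, f k ∈ (I • ⊤ : Submodule A M) → k ∈ (I • ⊤ : Submodule A K) := by
  have key (k : K) : BTensor.map (LinearMap.id : rightVia (Ideal.Quotient.mk I) →ₗ[Aᵐᵒᵖ] _) f
      (quotientTmul I k) = quotientTmul I (f k) := BTensor.map_tmul _ _ _ _
  rw [injective_iff_map_eq_zero]
  simp only [(quotientTmul_surjective I).forall, key, quotientTmul_eq_zero_iff]

/-- Every tensor has the form `1 ⊗ m` and is sent to `m`. -/
lemma epiMul_mk_bijective : Function.Bijective (epiMul (Ideal.Quotient.mk I)) := by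
  constructor
  · rw [injective_iff_map_eq_zero]
    intro x hx
    obtain ⟨m, rfl⟩ := quotientTmul_surjective I x
    have h : epiMul (Ideal.Quotient.mk I) (quotientTmul I m) = (m : A ⧸ I) :=
      one_mul (M := A ⧸ I) m
    rw [h] at hx
    exact (congrArg (quotientTmul I (M := leftVia (Ideal.Quotient.mk I))) hx).trans
      (BTensor.tmul_zero A _)
  · exact fun b => ⟨quotientTmul I (M := leftVia (Ideal.Quotient.mk I)) b, one_mul (M := A ⧸ I) b⟩

/-- The `A/I`-linear map `M/IM → Y` induced by an `A`-linear map from `M` to an `A/I`-module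
`Y`. -/
def quotientLift {Y : ModuleCat.{u} (A ⧸ I)}
    (g : M →ₗ[A] (ModuleCat.restrictScalars.{u} (Ideal.Quotient.mk I)).obj Y) :
    (M ⧸ (I • ⊤ : Submodule A M)) →ₗ[A ⧸ I] Y :=
  let h := Submodule.liftQ (I • ⊤ : Submodule A M) g (by
    rw [Submodule.smul_le]
    intro a ha m _
    rw [LinearMap.mem_ker, map_smul]
    have h0 : Ideal.Quotient.mk I a • (show Y from g m) = 0 := by
      rw [Ideal.Quotient.eq_zero_iff_mem.2 ha, zero_smul]
    exact h0)
  { toFun := fun x => h x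
    map_add' := fun x y => map_add h x y
    map_smul' := fun b x => by
      obtain ⟨a, rfl⟩ := Ideal.Quotient.mk_surjective (I := I) b
      exact map_smul h a x }

/-- The map `M/IM → M'/IM'` induced by a linear map. -/
def quotientMap {M' : Type u} [AddCommGroup M'] [Module A M'] (f : M →ₗ[A] M') :
    (M ⧸ (I • ⊤ : Submodule A M)) →ₗ[A ⧸ I] (M' ⧸ (I • ⊤ : Submodule A M')) :=
  let h := Submodule.mapQ (I • ⊤ : Submodule A M) (I • ⊤ : Submodule A M') f
    (Submodule.smul_top_le_comap_smul_top I f)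
  { toFun := h
    map_add' := map_add h
    map_smul' := fun b x => by
      obtain ⟨a, rfl⟩ := Ideal.Quotient.mk_surjective (I := I) b
      exact map_smul h a x }

lemma quotientMap_mk {M' : Type u} [AddCommGroup M'] [Module A M'] (f : M →ₗ[A] M') (m : M) :
    quotientMap I f (Submodule.Quotient.mk m) = Submodule.Quotient.mk (f m) := rfl

lemma quotient_finite (M : Type u) [AddCommGroup M] [Module A M] [Module.Finite A M] :
    Module.Finite (A ⧸ I) (M ⧸ (I • ⊤ : Submodule A M)) := by
  obtain ⟨s, hs⟩ := Module.Finite.fg_top (R := A) (M := M)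
  classical
  refine ⟨s.image (Submodule.Quotient.mk), eq_top_iff.2 fun x _ => ?_⟩
  obtain ⟨m, rfl⟩ := Submodule.Quotient.mk_surjective _ x
  have hm : m ∈ Submodule.span A (s : Set M) := hs ▸ Submodule.mem_top
  induction hm using Submodule.span_induction with
  | mem m hm => exact Submodule.subset_span (Finset.mem_coe.2 (Finset.mem_image_of_mem _ hm))
  | zero => exact Submodule.zero_mem _
  | add x y _ _ hx hy => exact Submodule.add_mem _ (hx trivial) (hy trivial)
  | smul a x _ hx => exact Submodule.smul_mem _ (Ideal.Quotient.mk I a) (hx trivial)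

/-- The projection `M → M/IM` lifts over `A` through any surjection from a free `A/I`-module, and
the lift factors through `M/IM`. -/
lemma quotient_projective [Module.Projective A M] :
    Module.Projective (A ⧸ I) (M ⧸ (I • ⊤ : Submodule A M)) := by
  refine Module.Projective.of_lifting_property'' fun f hf => ?_
  let Q := M ⧸ (I • ⊤ : Submodule A M)
  let F := ModuleCat.restrictScalars.{u} (Ideal.Quotient.mk I)
  let f' : F.obj (ModuleCat.of (A ⧸ I) (Q →₀ A ⧸ I)) →ₗ[A] Q :=
    { toFun := f
      map_add' := map_add f
      map_smul' := fun a x => f.map_smul (Ideal.Quotient.mk I a) x }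
  obtain ⟨h, hh⟩ := Module.projective_lifting_property f' (Submodule.mkQ _) hf
  refine ⟨quotientLift I (Y := ModuleCat.of (A ⧸ I) (Q →₀ A ⧸ I)) h, LinearMap.ext fun x => ?_⟩
  obtain ⟨m, rfl⟩ := Submodule.Quotient.mk_surjective _ x
  exact LinearMap.congr_fun hh m

section Presentation

variable {K P : Type u} [AddCommGroup K] [Module A K] [AddCommGroup P] [Module A P]
  {f : K →ₗ[A] P} {g : P →ₗ[A] M}

lemma quotientMap_surjective (hg : Function.Surjective g) :
    Function.Surjective (quotientMap I g) := by
  intro x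
  obtain ⟨m, rfl⟩ := Submodule.Quotient.mk_surjective _ x
  obtain ⟨p, rfl⟩ := hg m
  exact ⟨Submodule.Quotient.mk p, rfl⟩

lemma quotientMap_exact (h : Function.Exact f g) (hg : Function.Surjective g) :
    Function.Exact (quotientMap I f) (quotientMap I g) := by
  intro x
  obtain ⟨p, rfl⟩ := Submodule.Quotient.mk_surjective _ x
  rw [quotientMap_mk, Submodule.Quotient.mk_eq_zero]
  constructor
  · intro hp
    -- Since `g` maps `IP` onto `IM`, an element `p` with `g p` in `IM` may be changed modulo `IP`
    -- into one in the kernel of `g`.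
    have hmap : (I • ⊤ : Submodule A P).map g = I • ⊤ := by
      rw [Submodule.map_smul'', Submodule.map_top, LinearMap.range_eq_top.2 hg]
    rw [← hmap] at hp
    obtain ⟨q, hq, hqp⟩ := hp
    obtain ⟨k, hk⟩ := (h (p - q)).1 (by rw [map_sub, hqp, sub_self])
    refine ⟨Submodule.Quotient.mk k, ?_⟩
    rw [quotientMap_mk, hk, Submodule.Quotient.eq]
    simpa using hq
  · rintro ⟨y, hy⟩
    obtain ⟨k, rfl⟩ := Submodule.Quotient.mk_surjective _ y
    rw [← Submodule.Quotient.mk_eq_zero, ← quotientMap_mk, ← hy, quotientMap_mk, quotientMap_mk,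
      h.apply_apply_eq_zero, Submodule.Quotient.mk_zero]

lemma quotientMap_injective
    (hf : ∀ k, f k ∈ (I • ⊤ : Submodule A P) → k ∈ (I • ⊤ : Submodule A K)) :
    Function.Injective (quotientMap I f) := by
  rw [injective_iff_map_eq_zero]
  intro x hx
  obtain ⟨k, rfl⟩ := Submodule.Quotient.mk_surjective _ x
  rw [quotientMap_mk, Submodule.Quotient.mk_eq_zero] at hx
  exact (Submodule.Quotient.mk_eq_zero _).2 (hf k hx)

/-- The condition `hf` completes `K/IK → P/IP → M/IM` to a short exact sequence, which splits
because its right term is projective. -/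
lemma exists_quotientMap_retraction [Module.Projective (A ⧸ I) (M ⧸ (I • ⊤ : Submodule A M))]
    (h : Function.Exact f g) (hg : Function.Surjective g)
    (hf : ∀ k, f k ∈ (I • ⊤ : Submodule A P) → k ∈ (I • ⊤ : Submodule A K)) :
    ∃ r, r ∘ₗ quotientMap I f = LinearMap.id := by
  have hs := Module.projective_lifting_property (quotientMap I g) LinearMap.id
    (quotientMap_surjective I hg)
  exact (((quotientMap_exact I h hg).split_tfae (quotientMap_injective I hf)
    (quotientMap_surjective I hg)).out 0 1).1 hs

end Presentation

/-! ### Vanishing of `Tor(A/I, -)` compared with vanishing of Ext into `A/I`-modules. -/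

variable (A) in
lemma exists_projective_surjective (M : Type u) [AddCommGroup M] [Module A M] :
    ∃ (P : Type u) (_ : AddCommGroup P) (_ : Module A P) (_ : Module.Projective A P)
      (g : P →ₗ[A] M), Function.Surjective g :=
  ⟨M →₀ A, inferInstance, inferInstance, inferInstance, Finsupp.linearCombination A id,
    Finsupp.linearCombination_id_surjective A M⟩

open Abelian in
/-- If `Tor_i^A(A/I, M)` vanishes for `i ≥ 1` and `M/IM` is projective over `A/I`, then
`Ext^i_A(M, Y)` vanishes for `i ≥ 1` and every `A/I`-module `Y`. -/
theorem subsingleton_ext_of_isZero_tor (n : ℕ) (M : Type u) [AddCommGroup M] [Module A M]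
    (hM : ∀ i, Limits.IsZero (torGroup A (i + 1) (rightVia (Ideal.Quotient.mk I))
      (ModuleCat.of A M)))
    (hp : Module.Projective (A ⧸ I) (M ⧸ (I • ⊤ : Submodule A M))) (Y : ModuleCat.{u} (A ⧸ I)) :
    Subsingleton (Ext (ModuleCat.of A M)
      ((ModuleCat.restrictScalars.{u} (Ideal.Quotient.mk I)).obj Y) (n + 1)) := by
  induction n generalizing M with
  | zero =>
    obtain ⟨P, _, _, _, g, hg⟩ := exists_projective_surjective A M
    have h : Function.Exact g.ker.subtype g := LinearMap.exact_subtype_ker_map g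
    have hf : Function.Injective g.ker.subtype := Subtype.val_injective
    have hS := linearMap_shortExact hf h hg
    have h₁ := (quotientTensor_map_injective_iff I _).1
      ((isZero_torGroup_one_iff _ hf h hg).1 (hM 0))
    obtain ⟨r, hr⟩ := exists_quotientMap_retraction I h hg h₁
    refine (subsingleton_ext_one_iff hS _).2 fun a => ?_
    let F := ModuleCat.restrictScalars.{u} (Ideal.Quotient.mk I)
    -- The map `a` factors through `K/IK`; precomposing that factor with `P → P/IP` and the
    -- retraction `r` extends `a` to `P`.
    let b : P →ₗ[A] F.obj Y :=
      { toFun := fun p => quotientLift I a.hom (r (Submodule.Quotient.mk p))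
        map_add' := fun p q => by rw [Submodule.Quotient.mk_add, map_add, map_add]; rfl
        map_smul' := fun c p => by
          rw [← Module.Quotient.mk_smul_mk, map_smul, map_smul]; rfl }
    refine ⟨ModuleCat.ofHom (Y := F.obj Y) b, ?_⟩
    ext k
    have hk : r (Submodule.Quotient.mk (g.ker.subtype k)) = Submodule.Quotient.mk k :=
      LinearMap.congr_fun hr (Submodule.Quotient.mk k)
    exact congrArg (quotientLift I a.hom) hk
  | succ n ih =>
    obtain ⟨P, _, _, _, g, hg⟩ := exists_projective_surjective A M
    have h : Function.Exact g.ker.subtype g := LinearMap.exact_subtype_ker_map g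
    have hf : Function.Injective g.ker.subtype := Subtype.val_injective
    have hS := linearMap_shortExact hf h hg
    have h₁ := (quotientTensor_map_injective_iff I _).1
      ((isZero_torGroup_one_iff _ hf h hg).1 (hM 0))
    obtain ⟨r, hr⟩ := exists_quotientMap_retraction I h hg h₁
    refine (subsingleton_ext_add_two_iff hS _ n).2 ?_
    have := quotient_projective I (M := P)
    -- The kernel inherits both hypotheses: Tor shifts by one, and `r` makes `K/IK` a direct summand
    -- of the projective module `P/IP`.
    exact ih _ (fun i => (isZero_torGroup_add_two_iff _ hf h hg i).1 (hM (i + 1)))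
      (Module.Projective.of_split _ r hr)

open Abelian in
/-- Over a left noetherian ring, if `M` is finitely generated and `Ext^i_A(M, Y)` vanishes for
`i ≥ 1` and every finitely generated `A/I`-module `Y`, then `Tor_i^A(A/I, M)` vanishes for
`i ≥ 1`. -/
theorem isZero_tor_of_subsingleton_ext [IsNoetherianRing A] (n : ℕ) (M : Type u) [AddCommGroup M]
    [Module A M] [Module.Finite A M]
    (hM : ∀ (Y : ModuleCat.{u} (A ⧸ I)), Module.Finite (A ⧸ I) Y → ∀ i,
      Subsingleton (Ext (ModuleCat.of A M)
        ((ModuleCat.restrictScalars.{u} (Ideal.Quotient.mk I)).obj Y) (i + 1))) :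
    Limits.IsZero (torGroup A (n + 1) (rightVia (Ideal.Quotient.mk I)) (ModuleCat.of A M)) := by
  induction n generalizing M with
  | zero =>
    obtain ⟨d, g, hg⟩ := Module.Finite.exists_fin' A M
    have h : Function.Exact g.ker.subtype g := LinearMap.exact_subtype_ker_map g
    have hf : Function.Injective g.ker.subtype := Subtype.val_injective
    rw [isZero_torGroup_one_iff _ hf h hg, quotientTensor_map_injective_iff]
    intro k hk
    -- The universal test module is `K/IK`, finitely generated because `K` lies in a finite free
    -- module over a Noetherian ring.
    let Y := ModuleCat.of (A ⧸ I) (g.ker ⧸ (I • ⊤ : Submodule A g.ker))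
    have hY : Module.Finite (A ⧸ I) Y := quotient_finite I g.ker
    let F := ModuleCat.restrictScalars.{u} (Ideal.Quotient.mk I)
    let q : ModuleCat.of A g.ker ⟶ F.obj Y := ModuleCat.ofHom
      { toFun := fun k => Submodule.Quotient.mk k
        map_add' := fun _ _ => rfl
        map_smul' := fun _ _ => rfl }
    obtain ⟨b, hb⟩ := (subsingleton_ext_one_iff (linearMap_shortExact hf h hg) (F.obj Y)).1
      (hM Y hY 0) q
    have hbk : b.hom (g.ker.subtype k) = Submodule.Quotient.mk k :=
      LinearMap.congr_fun (congrArg ModuleCat.Hom.hom hb) k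
    -- The extension `b` of `K → K/IK` kills `IP`, so an element of `K` lying in `IP` has zero class
    -- in `K/IK`.
    have h0 : quotientLift I b.hom (Submodule.Quotient.mk (g.ker.subtype k)) =
      Submodule.Quotient.mk k := hbk
    rw [(Submodule.Quotient.mk_eq_zero _).2 hk, map_zero] at h0
    exact (Submodule.Quotient.mk_eq_zero _).1 h0.symm
  | succ n ih =>
    obtain ⟨d, g, hg⟩ := Module.Finite.exists_fin' A M
    have h : Function.Exact g.ker.subtype g := LinearMap.exact_subtype_ker_map g
    have hf : Function.Injective g.ker.subtype := Subtype.val_injective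
    rw [isZero_torGroup_add_two_iff _ hf h hg]
    exact ih g.ker fun Y hY i =>
      (subsingleton_ext_add_two_iff (linearMap_shortExact hf h hg) _ i).1 (hM Y hY (i + 1))

/-! ### Ext over `A/I` compared with Ext over `A`. -/

instance restrictScalars_mk_full :
    (ModuleCat.restrictScalars.{u} (Ideal.Quotient.mk I)).Full where
  map_surjective {X Y} f := ⟨ModuleCat.ofHom
    { toFun := fun x => f.hom x
      map_add' := fun x y => map_add f.hom x y
      map_smul' := fun b x => by
        obtain ⟨a, rfl⟩ := Ideal.Quotient.mk_surjective (I := I) b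
        exact f.hom.map_smul a x }, rfl⟩

open Abelian in
/-- If `Ext^i_A(A/I, Y)` vanishes, then so does `Ext^i_A((A/I)^d, Y)`. -/
lemma subsingleton_ext_pi (Y : ModuleCat.{u} A) (n d : ℕ)
    (h : Subsingleton (Ext (leftVia (Ideal.Quotient.mk I)) Y n)) :
    Subsingleton (Ext ((ModuleCat.restrictScalars.{u} (Ideal.Quotient.mk I)).obj
      (ModuleCat.of (A ⧸ I) (Fin d → A ⧸ I))) Y n) := by
  refine subsingleton_of_forall_eq 0 fun x => ?_
  let F := ModuleCat.restrictScalars.{u} (Ideal.Quotient.mk I)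
  let B := A ⧸ I
  let p (j : Fin d) : ModuleCat.of B (Fin d → B) ⟶ ModuleCat.of B B :=
    ModuleCat.ofHom (LinearMap.proj j)
  let s (j : Fin d) : ModuleCat.of B B ⟶ ModuleCat.of B (Fin d → B) :=
    ModuleCat.ofHom (LinearMap.single B (fun _ => B) j)
  -- Writing the identity as a sum of maps through `A/I` makes every Ext class a sum of classes
  -- coming from the vanishing group.
  have hid : 𝟙 (ModuleCat.of B (Fin d → B)) = ∑ j, p j ≫ s j := by
    refine ModuleCat.hom_ext (LinearMap.ext fun x => ?_)
    rw [ModuleCat.hom_sum, LinearMap.sum_apply]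
    exact (Finset.univ_sum_single (show Fin d → B from x)).symm
  rw [← Ext.mk₀_id_comp x, ← F.map_id, hid, F.map_sum, Ext.mk₀_sum, Ext.sum_comp]
  refine Finset.sum_eq_zero fun j _ => ?_
  rw [F.map_comp, ← Ext.mk₀_comp_mk₀_assoc, Subsingleton.elim ((Ext.mk₀ (F.map (s j))).comp x _) 0,
    Ext.comp_zero]

open Abelian in
/-- `I` is a strong idempotent ideal if and only if `Ext^i_A(A/I, Y)` vanishes for `i ≥ 1` and
every finitely generated `A/I`-module `Y`. -/
theorem isStrongIdempotentIdeal_iff [IsNoetherianRing A] :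
    IsStrongIdempotentIdeal I ↔ ∀ (Y : ModuleCat.{u} (A ⧸ I)), Module.Finite (A ⧸ I) Y → ∀ i,
      Subsingleton (Ext (leftVia (Ideal.Quotient.mk I))
        ((ModuleCat.restrictScalars.{u} (Ideal.Quotient.mk I)).obj Y) (i + 1)) := by
  constructor
  · intro h Y hY i
    -- The source `Ext_{A/I}(A/I, Y)` is zero in positive degree, so surjectivity of the comparison
    -- map kills the target.
    have := Ext.subsingleton_of_projective (ModuleCat.of (A ⧸ I) (A ⧸ I)) Y i
    exact (h (ModuleCat.of (A ⧸ I) (A ⧸ I)) Y (inferInstanceAs (Module.Finite (A ⧸ I) (A ⧸ I)))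
      hY (i + 1)).2.subsingleton
  · intro h X Y hX hY n
    let F := ModuleCat.restrictScalars.{u} (Ideal.Quotient.mk I)
    induction n generalizing X with
    | zero =>
      -- In degree zero the comparison is the action on Hom, bijective since restriction along `A →
      -- A/I` is fully faithful.
      rw [Functor.mapExtAddHom_coe, Ext.mapExactFunctor₀]
      exact (Ext.homEquiv₀.symm.bijective.comp
        ⟨F.map_injective, F.map_surjective⟩).comp Ext.homEquiv₀.bijective
    | succ n hn =>
      obtain ⟨d, g, hg⟩ := Module.Finite.exists_fin' (A ⧸ I) X
      let S := g.shortComplexKer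
      have hS : S.ShortExact := LinearMap.shortExact_shortComplexKer hg
      have hP : Projective S.X₂ :=
        inferInstanceAs (Projective (ModuleCat.of (A ⧸ I) (Fin d → A ⧸ I)))
      have hB : IsNoetherianRing (A ⧸ I) :=
        isNoetherianRing_of_surjective A _ (Ideal.Quotient.mk I) Ideal.Quotient.mk_surjective
      have hX₂ : Module.Finite (A ⧸ I) S.X₂ :=
        inferInstanceAs (Module.Finite (A ⧸ I) (Fin d → A ⧸ I))
      have hX₁ : Module.Finite (A ⧸ I) S.X₁ := inferInstanceAs (Module.Finite (A ⧸ I) g.ker)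
      have h₁ : Subsingleton (Ext S.X₂ Y (n + 1)) := Ext.subsingleton_of_projective _ _ _
      have h₂ : Subsingleton (Ext (S.map F).X₂ (F.obj Y) (n + 1)) :=
        subsingleton_ext_pi I _ _ d (h Y hY n)
      exact mapExtAddHom_bijective_succ F hS Y n h₁ h₂ (hn S.X₂ hX₂).surjective (hn _ hX₁)

end QuotientTensor

/-! ### The corner ring and the functor `M ↦ e M` -/

section Corner

variable {A : Type u} [Ring A]

/-- The additive group `e M`. -/
def cornerPart (e : A) (M : Type u) [AddCommGroup M] [Module A M] : AddSubgroup M :=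
  (DistribSMul.toAddMonoidHom M e).range

variable {e : A} (he : IsIdempotentElem e) {M : Type u} [AddCommGroup M] [Module A M]

lemma corner_mul_left (c : he.Corner) : e * c.1 = c.1 :=
  ((Subsemigroup.mem_corner_iff he).mp c.2).1

lemma corner_mul_right (c : he.Corner) : c.1 * e = c.1 :=
  ((Subsemigroup.mem_corner_iff he).mp c.2).2

include he in
lemma mem_cornerPart_iff (m : M) : m ∈ cornerPart e M ↔ e • m = m := by
  constructor
  · rintro ⟨m, rfl⟩
    change e • e • m = e • m
    rw [← mul_smul, he.eq]
  · exact fun h => ⟨m, h⟩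

include he in
lemma mem_groupAe_iff (a : A) : a ∈ groupAe e ↔ a * e = a := by
  constructor
  · rintro ⟨a, rfl⟩
    change a * e * e = a * e
    rw [mul_assoc, he.eq]
  · exact fun h => ⟨a, h⟩

lemma smul_mem_cornerPart (c : he.Corner) (m : M) : c.1 • m ∈ cornerPart e M := by
  rw [mem_cornerPart_iff he, ← mul_smul, corner_mul_left]

/-- `e M` is a left module over the ring `eAe`. -/
instance cornerPartModule : Module he.Corner (cornerPart e M) where
  smul c x := ⟨c.1 • x.1, smul_mem_cornerPart he c x.1⟩
  one_smul x := Subtype.ext ((mem_cornerPart_iff he x.1).1 x.2)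
  mul_smul c d x := Subtype.ext (mul_smul c.1 d.1 x.1)
  smul_zero _ := Subtype.ext (smul_zero _)
  smul_add _ _ _ := Subtype.ext (smul_add _ _ _)
  add_smul _ _ _ := Subtype.ext (add_smul _ _ _)
  zero_smul _ := Subtype.ext (zero_smul _ _)

lemma coe_corner_smul (c : he.Corner) (x : cornerPart e M) :
    ((c • x : cornerPart e M) : M) = c.1 • (x : M) := rfl

/-- The map `e M → e M'` induced by a linear map `M → M'`. -/
def cornerMap {M' : Type u} [AddCommGroup M'] [Module A M'] (f : M →ₗ[A] M') :
    cornerPart e M →ₗ[he.Corner] cornerPart e M' where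
  toFun x := ⟨f x.1, by
    rw [mem_cornerPart_iff he, ← map_smul, (mem_cornerPart_iff he x.1).1 x.2]⟩
  map_add' x y := Subtype.ext (map_add f _ _)
  map_smul' c x := Subtype.ext (map_smul f c.1 x.1)

section Exact

variable {K P : Type u} [AddCommGroup K] [Module A K] [AddCommGroup P] [Module A P]
  {f : K →ₗ[A] P} {g : P →ₗ[A] M}

lemma cornerMap_injective (hf : Function.Injective f) : Function.Injective (cornerMap he f) :=
  fun _ _ h => Subtype.ext (hf (congrArg Subtype.val h))

lemma cornerMap_surjective (hg : Function.Surjective g) :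
    Function.Surjective (cornerMap he g) := by
  intro m
  obtain ⟨p, hp⟩ := hg m.1
  refine ⟨⟨e • p, p, rfl⟩, Subtype.ext ?_⟩
  change g (e • p) = m.1
  rw [map_smul, hp, (mem_cornerPart_iff he m.1).1 m.2]

lemma cornerMap_exact (hf : Function.Injective f) (h : Function.Exact f g) :
    Function.Exact (cornerMap he f) (cornerMap he g) := by
  intro x
  constructor
  · intro hx
    obtain ⟨k, hk⟩ := (h x.1).1 (congrArg Subtype.val hx)
    refine ⟨⟨k, ?_⟩, Subtype.ext hk⟩
    rw [mem_cornerPart_iff he]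
    apply hf
    rw [map_smul, hk, (mem_cornerPart_iff he x.1).1 x.2]
  · rintro ⟨k, rfl⟩
    exact Subtype.ext (h.apply_apply_eq_zero k.1)

end Exact

variable (M) in
/-- The map `Ae ⊗_{eAe} eM → M`, `a ⊗ m ↦ a m`. -/
def cornerCounit : BTensor he.Corner (groupAe e) (cornerPart e M) →+ M :=
  BTensor.lift he.Corner
    (AddMonoidHom.mk'
      (fun x : groupAe e => (DistribSMul.toAddMonoidHom M x.1).comp (cornerPart e M).subtype)
      (fun x y => AddMonoidHom.ext fun m => add_smul x.1 y.1 m.1))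
    (fun x c m => mul_smul x.1 c.1 m.1)

lemma cornerCounit_tmul (x : groupAe e) (m : cornerPart e M) :
    cornerCounit he M (BTensor.tmul he.Corner x m) = x.1 • m.1 := rfl

lemma cornerCounit_naturality {M' : Type u} [AddCommGroup M'] [Module A M'] (f : M →ₗ[A] M')
    (t : BTensor he.Corner (groupAe e) (cornerPart e M)) :
    cornerCounit he M' (BTensor.map LinearMap.id (cornerMap he f) t) =
      f (cornerCounit he M t) := by
  induction t using BTensor.induction_on with
  | zero => simp only [map_zero]
  | tmul x m =>
    rw [BTensor.map_tmul, cornerCounit_tmul, cornerCounit_tmul, map_smul]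
    rfl
  | add x y hx hy => simp only [map_add, hx, hy]

lemma groupAe_mem_ideal (x : groupAe e) : x.1 ∈ idealAeA e := by
  obtain ⟨_, a, rfl⟩ := x
  exact Ideal.subset_span ⟨(a, 1), mul_one _⟩

/-- The counit is set up only as an additive map; this supplies stability of its image under `A`. -/
lemma smul_cornerCounit (a : A) (t : BTensor he.Corner (groupAe e) (cornerPart e M)) :
    ∃ t', cornerCounit he M t' = a • cornerCounit he M t := by
  induction t using BTensor.induction_on with
  | zero => exact ⟨0, by simp only [map_zero, smul_zero]⟩
  | tmul x m =>
    refine ⟨BTensor.tmul he.Corner ⟨a * x.1, ?_⟩ m, ?_⟩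
    · rw [mem_groupAe_iff he, mul_assoc, (mem_groupAe_iff he x.1).1 x.2]
    · exact mul_smul a x.1 m.1
  | add x y hx hy =>
    obtain ⟨x', hx⟩ := hx
    obtain ⟨y', hy⟩ := hy
    exact ⟨x' + y', by rw [map_add, map_add, smul_add, hx, hy]⟩

/-- The generator `(p e q) m` is the image of `p e ⊗ e q m`, because `e` is idempotent. -/
lemma mem_range_cornerCounit_iff (m : M) :
    m ∈ (cornerCounit he M).range ↔ m ∈ (idealAeA e • ⊤ : Submodule A M) := by
  constructor
  · rintro ⟨t, rfl⟩
    induction t using BTensor.induction_on with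
    | zero => rw [map_zero]; exact Submodule.zero_mem _
    | tmul x m => exact Submodule.smul_mem_smul (groupAe_mem_ideal x) trivial
    | add x y hx hy => rw [map_add]; exact Submodule.add_mem _ hx hy
  · intro h
    refine Submodule.smul_induction_on h (fun a ha m _ => ?_) (fun x y hx hy => add_mem hx hy)
    induction ha using Submodule.span_induction with
    | mem a ha =>
      obtain ⟨⟨p, q⟩, rfl⟩ := ha
      refine ⟨BTensor.tmul he.Corner ⟨p * e, p, rfl⟩ ⟨e • q • m, q • m, rfl⟩, ?_⟩
      rw [cornerCounit_tmul]
      simp only [← mul_smul, mul_assoc, ← mul_assoc e e, he.eq]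
    | zero => rw [zero_smul]; exact zero_mem _
    | add x y _ _ hx hy => rw [add_smul]; exact add_mem hx hy
    | smul c x _ hx =>
      obtain ⟨t, ht⟩ := hx
      rw [smul_eq_mul, mul_smul, ← ht]
      exact smul_cornerCounit he c t

lemma cornerCounit_surjective_iff :
    Function.Surjective (cornerCounit he M) ↔ ∀ m, m ∈ (idealAeA e • ⊤ : Submodule A M) :=
  forall_congr' fun m => mem_range_cornerCounit_iff he m

/-! ### Covers by sums of copies of `Ae` -/

variable (e) in
/-- The left ideal `Ae`. -/
abbrev leftIdealAe : Submodule A A := LinearMap.range (LinearMap.toSpanSingleton A A e)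

include he in
lemma leftIdealAe_mul (x : leftIdealAe e) : x.1 * e = x.1 := by
  obtain ⟨_, a, rfl⟩ := x
  change a * e * e = a * e
  rw [mul_assoc, he.eq]

section Cover

variable (J : Type u)

include he in
-- Right multiplication by `e` retracts `A` onto `Ae`, so the sum is a direct summand of a free
-- module.
lemma cover_projective : Module.Projective A (J →₀ leftIdealAe e) :=
  Module.Projective.of_split (Finsupp.mapRange.linearMap (leftIdealAe e).subtype)
    (Finsupp.mapRange.linearMap (LinearMap.toSpanSingleton A A e).rangeRestrict)
    (LinearMap.ext fun x => Finsupp.ext fun j => Subtype.ext (leftIdealAe_mul he (x j)))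

/-- The generator `e` of the summand of `(Ae)^(J)` with index `j`, as an element of
`e (Ae)^(J)`. -/
def coverCornerBasis (j : J) : cornerPart e (J →₀ leftIdealAe e) :=
  ⟨Finsupp.single j ⟨e, 1, one_mul e⟩, by
    rw [mem_cornerPart_iff he, Finsupp.smul_single]
    congr 1
    exact Subtype.ext he.eq⟩

lemma coe_coverCornerBasis (j : J) : (coverCornerBasis he J j : J →₀ leftIdealAe e) =
    Finsupp.single j ⟨e, 1, one_mul e⟩ := rfl

lemma corner_smul_coverCornerBasis (c : he.Corner) (j : J) :
    ((c • coverCornerBasis he J j : cornerPart e (J →₀ leftIdealAe e)) : J →₀ leftIdealAe e) =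
      Finsupp.single j ⟨c.1, c.1, corner_mul_right he c⟩ := by
  rw [coe_corner_smul, coe_coverCornerBasis, Finsupp.smul_single]
  congr 1
  exact Subtype.ext (corner_mul_right he c)

lemma coe_linearCombination_coverCornerBasis (c : J →₀ he.Corner) (j : J) :
    ((Finsupp.linearCombination he.Corner (coverCornerBasis he J) c).1 j).1 = (c j).1 := by
  induction c using Finsupp.induction_linear with
  | zero => rfl
  | add c d hc hd =>
    rw [map_add]
    exact congrArg₂ (· + ·) hc hd
  | single i c =>
    rw [Finsupp.linearCombination_single, corner_smul_coverCornerBasis]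
    classical
    by_cases h : i = j
    · subst h
      rw [Finsupp.single_eq_same, Finsupp.single_eq_same]
    · rw [Finsupp.single_eq_of_ne' h, Finsupp.single_eq_of_ne' h]
      rfl

/-- The coordinates of an element of `e (Ae)^(J)`. -/
def coverCornerRepr : cornerPart e (J →₀ leftIdealAe e) →ₗ[he.Corner] (J →₀ he.Corner) where
  -- Coordinates of elements of `e (Ae)^(J)` are already fixed by left multiplication by `e`;
  -- inserting `e` lands every coordinate in `eAe` and fixes the value at zero.
  toFun x := x.1.mapRange (fun l => ⟨e * l.1, (Subsemigroup.mem_corner_iff he).2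
    ⟨by rw [← mul_assoc, he.eq], by rw [mul_assoc, leftIdealAe_mul he]⟩⟩)
    (Subtype.ext (mul_zero e))
  map_add' x y := Finsupp.ext fun j => Subtype.ext (mul_add e (x.1 j).1 (y.1 j).1)
  map_smul' c x := Finsupp.ext fun j => Subtype.ext (by
    have h : (e • x.1) j = x.1 j := DFunLike.congr_fun ((mem_cornerPart_iff he x.1).1 x.2) j
    have h' : e * (x.1 j).1 = (x.1 j).1 := congrArg Subtype.val h
    change e * (c.1 * (x.1 j).1) = c.1 * (e * (x.1 j).1)
    rw [h', ← mul_assoc, corner_mul_left])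

lemma linearCombination_comp_coverCornerRepr :
    Finsupp.linearCombination he.Corner (coverCornerBasis he J) ∘ₗ coverCornerRepr he J =
      LinearMap.id := by
  refine LinearMap.ext fun x => Subtype.ext (Finsupp.ext fun j => Subtype.ext ?_)
  refine (coe_linearCombination_coverCornerBasis he J _ j).trans ?_
  exact congrArg Subtype.val (DFunLike.congr_fun ((mem_cornerPart_iff he x.1).1 x.2) j)

lemma cover_corner_projective :
    Module.Projective he.Corner (cornerPart e (J →₀ leftIdealAe e)) :=
  Module.Projective.of_split _ _ (linearCombination_comp_coverCornerRepr he J)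

/-- The inverse of `Ae ⊗_{eAe} e (Ae)^(J) → (Ae)^(J)`. -/
def coverCounitInv : (J →₀ leftIdealAe e) →+
    BTensor he.Corner (groupAe e) (cornerPart e (J →₀ leftIdealAe e)) :=
  Finsupp.liftAddHom fun j => AddMonoidHom.mk'
    (fun l => BTensor.tmul he.Corner
      (⟨l.1, (mem_groupAe_iff he l.1).2 (leftIdealAe_mul he l)⟩ : groupAe e)
      (coverCornerBasis he J j))
    (fun _ _ => BTensor.add_tmul he.Corner _ _ _)

lemma coverCounitInv_single (j : J) (l : leftIdealAe e) :
    coverCounitInv he J (Finsupp.single j l) = BTensor.tmul he.Corner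
      (⟨l.1, (mem_groupAe_iff he l.1).2 (leftIdealAe_mul he l)⟩ : groupAe e)
      (coverCornerBasis he J j) :=
  Finsupp.liftAddHom_apply_single _ _ _

/-- Each coefficient `c_j` in `eAe` moves across the tensor sign, turning `x ⊗ c_j b_j` into `x c_j
⊗ b_j`. -/
lemma coverCounitInv_smul (x : groupAe e) (c : J →₀ he.Corner) :
    coverCounitInv he J (x.1 •
        (Finsupp.linearCombination he.Corner (coverCornerBasis he J) c : J →₀ leftIdealAe e)) =
      BTensor.tmul he.Corner x
        (Finsupp.linearCombination he.Corner (coverCornerBasis he J) c) := by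
  induction c using Finsupp.induction_linear with
  | zero => rw [map_zero, BTensor.tmul_zero, AddSubgroup.coe_zero, smul_zero, map_zero]
  | add c d hc hd =>
    rw [map_add, BTensor.tmul_add, ← hc, ← hd, AddSubgroup.coe_add, smul_add, map_add]
  | single j c =>
    rw [Finsupp.linearCombination_single, corner_smul_coverCornerBasis, Finsupp.smul_single,
      ← BTensor.smul_tmul, coverCounitInv_single]
    rfl

lemma cornerCounit_cover_injective :
    Function.Injective (cornerCounit he (J →₀ leftIdealAe e)) := by
  refine Function.LeftInverse.injective (g := coverCounitInv he J) fun t => ?_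
  induction t using BTensor.induction_on with
  | zero => rw [map_zero, map_zero]
  | tmul x y =>
    obtain ⟨c, rfl⟩ : ∃ c, Finsupp.linearCombination he.Corner (coverCornerBasis he J) c = y :=
      ⟨_, LinearMap.congr_fun (linearCombination_comp_coverCornerRepr he J) y⟩
    exact coverCounitInv_smul he J x c
  | add x y hx hy => rw [map_add, map_add, hx, hy]

lemma cornerCounit_cover_surjective :
    Function.Surjective (cornerCounit he (J →₀ leftIdealAe e)) := by
  intro p
  induction p using Finsupp.induction_linear with
  | zero => exact ⟨0, map_zero _⟩
  | add p q hp hq =>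
    obtain ⟨s, rfl⟩ := hp
    obtain ⟨t, rfl⟩ := hq
    exact ⟨s + t, map_add _ _ _⟩
  | single j l =>
    refine ⟨BTensor.tmul he.Corner (⟨l.1, (mem_groupAe_iff he l.1).2 (leftIdealAe_mul he l)⟩ :
      groupAe e) (coverCornerBasis he J j), ?_⟩
    rw [cornerCounit_tmul, coe_coverCornerBasis, Finsupp.smul_single]
    congr 1
    exact Subtype.ext (leftIdealAe_mul he l)

end Cover

lemma exists_corner_cover (hM : ∀ m, m ∈ (idealAeA e • ⊤ : Submodule A M)) :
    ∃ (P : Type u) (_ : AddCommGroup P) (_ : Module A P) (_ : Module.Projective A P)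
      (_ : Module.Projective he.Corner (cornerPart e P)) (g : P →ₗ[A] M),
      Function.Bijective (cornerCounit he P) ∧ Function.Surjective g := by
  -- One copy of `Ae` for each `m` in `eM`, mapped by `l ↦ l m`; the image is `Ae · eM`, which is
  -- all of `M` by `hM`.
  let g : (cornerPart e M →₀ leftIdealAe e) →ₗ[A] M :=
    Finsupp.lsum ℕ fun j => (LinearMap.toSpanSingleton A M j.1).comp (leftIdealAe e).subtype
  refine ⟨cornerPart e M →₀ leftIdealAe e, inferInstance, inferInstance,
    cover_projective he _, cover_corner_projective he _, g, ⟨cornerCounit_cover_injective he _,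
    cornerCounit_cover_surjective he _⟩, fun m => ?_⟩
  obtain ⟨t, rfl⟩ := (cornerCounit_surjective_iff he).2 hM m
  induction t using BTensor.induction_on with
  | zero => exact ⟨0, by rw [map_zero, map_zero]⟩
  | tmul x y =>
    refine ⟨Finsupp.single y ⟨x.1, x.1, (mem_groupAe_iff he x.1).1 x.2⟩, ?_⟩
    exact Finsupp.lsum_single _ _ _ _
  | add x y hx hy =>
    obtain ⟨x', hx⟩ := hx
    obtain ⟨y', hy⟩ := hy
    exact ⟨x' + y', by rw [map_add, map_add, hx, hy]⟩

end Corner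

/-! ### The `A`-module `A/I`. -/

section QuotientModule

variable {A : Type u} [Ring A] (I : Ideal A) [I.IsTwoSided]

/-- The projection `A → A/I` as a homomorphism of left `A`-modules. -/
def quotientToLeftVia : A →ₗ[A] leftVia (Ideal.Quotient.mk I) where
  toFun := Ideal.Quotient.mk I
  map_add' := map_add (Ideal.Quotient.mk I)
  map_smul' := map_mul (Ideal.Quotient.mk I)

/-- For `M = A/I` the module `M/IM` is a retract of `A/I`, generated by the class of `1`. This
starts the induction from Tor to Ext. -/
lemma leftVia_quotient_projective : Module.Projective (A ⧸ I)
    (leftVia (Ideal.Quotient.mk I) ⧸ (I • ⊤ : Submodule A (leftVia (Ideal.Quotient.mk I)))) := by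
  let q : leftVia (Ideal.Quotient.mk I) ⧸
    (I • ⊤ : Submodule A (leftVia (Ideal.Quotient.mk I))) :=
      Submodule.Quotient.mk (quotientToLeftVia I 1)
  let p := quotientLift I (M := leftVia (Ideal.Quotient.mk I))
    (Y := ModuleCat.of (A ⧸ I) (A ⧸ I)) LinearMap.id
  refine Module.Projective.of_split p (LinearMap.toSpanSingleton (A ⧸ I) _ q)
    (LinearMap.ext fun x => ?_)
  obtain ⟨b, rfl⟩ := Submodule.Quotient.mk_surjective _ x
  obtain ⟨a, rfl⟩ := Ideal.Quotient.mk_surjective (I := I) b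
  change Submodule.Quotient.mk (a • quotientToLeftVia I 1) = _
  rw [← map_smul, smul_eq_mul, mul_one]
  rfl

end QuotientModule

section CornerSyzygy

/-! ### Comparison of Tor over `A` and over `eAe` -/

variable {A : Type u} [Ring A] {e : A} (he : IsIdempotentElem e)

section Presentation

variable {K P M : Type u} [AddCommGroup K] [Module A K] [AddCommGroup P] [Module A P]
  [AddCommGroup M] [Module A M] {f : K →ₗ[A] P} {g : P →ₗ[A] M}

/-- A snake argument: compare the right exact sequence `Ae ⊗ eK → Ae ⊗ eP → Ae ⊗ eM → 0` with `0 → K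
→ P → M → 0`. As the counit of `P` is bijective, the kernel at `M` is the cokernel at `K`. -/
lemma cornerCounit_injective_iff (hP : Function.Bijective (cornerCounit he P))
    (hf : Function.Injective f) (h : Function.Exact f g) (hg : Function.Surjective g) :
    Function.Injective (cornerCounit he M) ↔ Function.Surjective (cornerCounit he K) := by
  have hex := BTensor.map_exact (groupAe e) (cornerMap_exact he hf h) (cornerMap_surjective he hg)
  have hsurj := BTensor.map_surjective (groupAe e) (cornerMap_surjective he hg)
  constructor
  · intro hM k
    obtain ⟨y, hy⟩ := hP.2 (f k)
    obtain ⟨z, rfl⟩ := (hex y).1 (hM (by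
      rw [cornerCounit_naturality, hy, h.apply_apply_eq_zero, map_zero]))
    rw [cornerCounit_naturality] at hy
    exact ⟨z, hf hy⟩
  · intro hK
    rw [injective_iff_map_eq_zero]
    intro x hx
    obtain ⟨y, rfl⟩ := hsurj x
    rw [cornerCounit_naturality] at hx
    obtain ⟨k, hk⟩ := (h _).1 hx
    obtain ⟨z, rfl⟩ := hK k
    rw [← cornerCounit_naturality] at hk
    exact (hex y).2 ⟨z, hP.1 hk⟩

/-- By naturality, both maps become the same map into `P` after composition with injections. -/
lemma map_cornerMap_injective_iff (hP : Function.Injective (cornerCounit he P))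
    (hf : Function.Injective f) :
    Function.Injective (BTensor.map (LinearMap.id : groupAe e →ₗ[he.Cornerᵐᵒᵖ] groupAe e)
      (cornerMap he f)) ↔ Function.Injective (cornerCounit he K) := by
  have hcomp : f ∘ cornerCounit he K = cornerCounit he P ∘
      BTensor.map (LinearMap.id : groupAe e →ₗ[he.Cornerᵐᵒᵖ] groupAe e) (cornerMap he f) :=
    funext fun t => (cornerCounit_naturality he f t).symm
  rw [← hf.of_comp_iff, hcomp, hP.of_comp_iff]

/-- Surjectivity of the counit of `P` gives `P = IP`, so the condition `K ∩ IP ⊆ IK` becomes `K =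
IK`. -/
lemma isZero_torGroup_one_iff_cornerCounit [Module.Projective A P]
    (hP : Function.Bijective (cornerCounit he P))
    (hf : Function.Injective f) (h : Function.Exact f g) (hg : Function.Surjective g) :
    Limits.IsZero (torGroup A 1 (rightVia (Ideal.Quotient.mk (idealAeA e))) (ModuleCat.of A M)) ↔
      Function.Surjective (cornerCounit he K) := by
  rw [isZero_torGroup_one_iff _ hf h hg, quotientTensor_map_injective_iff,
    cornerCounit_surjective_iff]
  exact forall_congr' fun k => ⟨fun hk => hk ((cornerCounit_surjective_iff he).1 hP.2 _),
    fun hk _ => hk⟩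

end Presentation

lemma cornerCounit_injective_of_isZero_tor (M : Type u) [AddCommGroup M] [Module A M]
    (hM : ∀ m, m ∈ (idealAeA e • ⊤ : Submodule A M))
    (hT : Limits.IsZero (torGroup A 1 (rightVia (Ideal.Quotient.mk (idealAeA e)))
      (ModuleCat.of A M))) :
    Function.Injective (cornerCounit he M) := by
  obtain ⟨P, _, _, _, _, g, hP, hg⟩ := exists_corner_cover he hM
  have h : Function.Exact g.ker.subtype g := LinearMap.exact_subtype_ker_map g
  have hf : Function.Injective g.ker.subtype := Subtype.val_injective
  exact (cornerCounit_injective_iff he hP hf h hg).2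
    ((isZero_torGroup_one_iff_cornerCounit he hP hf h hg).1 hT)

/-- If `M = AeM` and `Tor_i^A(A/AeA, M)` vanishes for `i ≥ 1`, then so does
`Tor_i^{eAe}(Ae, eM)`. -/
theorem isZero_corner_tor_of_isZero_tor (n : ℕ) (M : Type u) [AddCommGroup M] [Module A M]
    (hM : ∀ m, m ∈ (idealAeA e • ⊤ : Submodule A M))
    (hT : ∀ i, Limits.IsZero (torGroup A (i + 1) (rightVia (Ideal.Quotient.mk (idealAeA e)))
      (ModuleCat.of A M))) :
    Limits.IsZero (torGroup he.Corner (n + 1) (ModuleCat.of (he.Corner)ᵐᵒᵖ (groupAe e))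
      (ModuleCat.of he.Corner (cornerPart e M))) := by
  induction n generalizing M with
  | zero =>
    obtain ⟨P, _, _, _, _, g, hP, hg⟩ := exists_corner_cover he hM
    have h : Function.Exact g.ker.subtype g := LinearMap.exact_subtype_ker_map g
    have hf : Function.Injective g.ker.subtype := Subtype.val_injective
    have hK := (isZero_torGroup_one_iff_cornerCounit he hP hf h hg).1 (hT 0)
    refine (isZero_torGroup_one_iff _ (cornerMap_injective he hf) (cornerMap_exact he hf h)
      (cornerMap_surjective he hg)).2 ((map_cornerMap_injective_iff he hP.1 hf).2 ?_)
    -- `Tor_1` over `eAe` consumes two groups over `A`: `Tor_1` gives `K = IK`, and `Tor_2(A/I, M)`,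
    -- shifted to `Tor_1(A/I, K)`, gives injectivity of the counit of `K`.
    exact cornerCounit_injective_of_isZero_tor he g.ker ((cornerCounit_surjective_iff he).1 hK)
      ((isZero_torGroup_add_two_iff _ hf h hg 0).1 (hT 1))
  | succ n ih =>
    obtain ⟨P, _, _, _, _, g, hP, hg⟩ := exists_corner_cover he hM
    have h : Function.Exact g.ker.subtype g := LinearMap.exact_subtype_ker_map g
    have hf : Function.Injective g.ker.subtype := Subtype.val_injective
    have hK := (isZero_torGroup_one_iff_cornerCounit he hP hf h hg).1 (hT 0)
    rw [isZero_torGroup_add_two_iff _ (cornerMap_injective he hf) (cornerMap_exact he hf h)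
      (cornerMap_surjective he hg)]
    exact ih g.ker ((cornerCounit_surjective_iff he).1 hK)
      fun i => (isZero_torGroup_add_two_iff _ hf h hg i).1 (hT (i + 1))

/-- If `M = AeM`, `Ae ⊗_{eAe} eM → M` is injective and `Tor_i^{eAe}(Ae, eM)` vanishes for
`i ≥ 1`, then so does `Tor_i^A(A/AeA, M)`. -/
theorem isZero_tor_of_isZero_corner_tor (n : ℕ) (M : Type u) [AddCommGroup M] [Module A M]
    (hM : ∀ m, m ∈ (idealAeA e • ⊤ : Submodule A M))
    (hε : Function.Injective (cornerCounit he M))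
    (hT : ∀ i, Limits.IsZero (torGroup he.Corner (i + 1)
      (ModuleCat.of (he.Corner)ᵐᵒᵖ (groupAe e)) (ModuleCat.of he.Corner (cornerPart e M)))) :
    Limits.IsZero (torGroup A (n + 1) (rightVia (Ideal.Quotient.mk (idealAeA e)))
      (ModuleCat.of A M)) := by
  induction n generalizing M with
  | zero =>
    obtain ⟨P, _, _, _, _, g, hP, hg⟩ := exists_corner_cover he hM
    have h : Function.Exact g.ker.subtype g := LinearMap.exact_subtype_ker_map g
    have hf : Function.Injective g.ker.subtype := Subtype.val_injective
    exact (isZero_torGroup_one_iff_cornerCounit he hP hf h hg).2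
      ((cornerCounit_injective_iff he hP hf h hg).1 hε)
  | succ n ih =>
    obtain ⟨P, _, _, _, _, g, hP, hg⟩ := exists_corner_cover he hM
    have h : Function.Exact g.ker.subtype g := LinearMap.exact_subtype_ker_map g
    have hf : Function.Injective g.ker.subtype := Subtype.val_injective
    have hcf := cornerMap_injective he hf
    have hch := cornerMap_exact he hf h
    have hcg := cornerMap_surjective he hg
    rw [isZero_torGroup_add_two_iff _ hf h hg]
    -- Injectivity at `M` yields `K = IK`, and the vanishing of `Tor_1^{eAe}(Ae, eM)` yields
    -- injectivity at `K`, so both hypotheses on the module pass to the kernel.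
    refine ih g.ker ((cornerCounit_surjective_iff he).1
      ((cornerCounit_injective_iff he hP hf h hg).1 hε)) ?_ fun i => ?_
    · exact (map_cornerMap_injective_iff he hP.1 hf).1
        ((isZero_torGroup_one_iff _ hcf hch hcg).1 (hT 0))
    · exact (isZero_torGroup_add_two_iff _ hcf hch hcg i).1 (hT (i + 1))

/-! ### The ideal `AeA` -/

include he in
-- `AeA` is an idempotent ideal: `p e q = (p e)(e q)`.
lemma mem_idealAeA_smul_top (x : idealAeA e) :
    x ∈ (idealAeA e • ⊤ : Submodule A (idealAeA e)) := by
  obtain ⟨x, hx⟩ := x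
  induction hx using Submodule.span_induction with
  | mem a ha =>
    obtain ⟨⟨p, q⟩, rfl⟩ := ha
    have hp : p * e ∈ idealAeA e := Ideal.subset_span ⟨(p, 1), mul_one _⟩
    have hq : e * q ∈ idealAeA e := Ideal.subset_span ⟨(1, q), by simp⟩
    have h := Submodule.smul_mem_smul hp (Submodule.mem_top (x := (⟨e * q, hq⟩ : idealAeA e)))
    convert h using 1
    refine Subtype.ext ?_
    change p * e * q = p * e * (e * q)
    rw [← mul_assoc, mul_assoc p e e, he.eq]
  | zero => exact Submodule.zero_mem _
  | add x y _ _ hx hy => exact Submodule.add_mem _ hx hy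
  | smul c x _ hx => exact Submodule.smul_mem _ c hx

/-- The isomorphism `e (AeA) ≅ eA` of left modules over `eAe`. -/
def cornerIdealEquiv : cornerPart e (idealAeA e) ≃ₗ[he.Corner] groupEA e where
  toFun x := ⟨x.1.1, x.1.1, congrArg Subtype.val ((mem_cornerPart_iff he x.1).1 x.2)⟩
  invFun y := ⟨⟨y.1, by
      obtain ⟨_, a, rfl⟩ := y
      exact Ideal.subset_span ⟨(1, a), by simp⟩⟩, by
    rw [mem_cornerPart_iff he]
    obtain ⟨_, a, rfl⟩ := y
    refine Subtype.ext ?_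
    change e * (e * a) = e * a
    rw [← mul_assoc, he.eq]⟩
  map_add' _ _ := rfl
  map_smul' _ _ := rfl
  left_inv _ := rfl
  right_inv _ := rfl

/-- Under `e(AeA) ≅ eA` the multiplication map is the counit of `AeA`, whose surjectivity is
idempotence of the ideal. -/
lemma cornerMul_bijective_iff :
    Function.Bijective (cornerMul he) ↔ Function.Injective (cornerCounit he (idealAeA e)) := by
  let θ := BTensor.map (LinearMap.id : groupAe e →ₗ[he.Cornerᵐᵒᵖ] groupAe e)
    (cornerIdealEquiv he).toLinearMap
  let θ' := BTensor.map (LinearMap.id : groupAe e →ₗ[he.Cornerᵐᵒᵖ] groupAe e)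
    (cornerIdealEquiv he).symm.toLinearMap
  have h₁ : (cornerMul he).comp θ = cornerCounit he (idealAeA e) :=
    BTensor.addHom_ext fun _ _ => rfl
  have h₂ : Function.Bijective θ := Function.bijective_iff_has_inverse.2 ⟨θ',
    DFunLike.congr_fun (BTensor.addHom_ext fun _ _ => rfl : θ'.comp θ = AddMonoidHom.id _),
    DFunLike.congr_fun (BTensor.addHom_ext fun _ _ => rfl : θ.comp θ' = AddMonoidHom.id _)⟩
  have h₃ : Function.Bijective (cornerMul he) ↔
      Function.Bijective (cornerCounit he (idealAeA e)) := by
    rw [← h₁, AddMonoidHom.coe_comp, h₂.of_comp_iff]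
  rw [h₃]
  exact ⟨fun h => h.1, fun h => ⟨h, (cornerCounit_surjective_iff he).2 (mem_idealAeA_smul_top he)⟩⟩

include he in
-- Shift along `0 → I → A → A/I → 0`. The remaining group `Tor_1(A/I, A/I)` vanishes because `I =
-- I²`.
lemma isZero_torGroup_quotient_iff :
    (∀ n, 1 ≤ n → Limits.IsZero (torGroup A n (rightVia (Ideal.Quotient.mk (idealAeA e)))
      (leftVia (Ideal.Quotient.mk (idealAeA e))))) ↔
    ∀ i, Limits.IsZero (torGroup A (i + 1) (rightVia (Ideal.Quotient.mk (idealAeA e)))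
      (ModuleCat.of A (idealAeA e))) := by
  let I := idealAeA e
  let g := quotientToLeftVia I
  have hf : Function.Injective I.subtype := Subtype.val_injective
  have hg : Function.Surjective g := Ideal.Quotient.mk_surjective
  have h : Function.Exact I.subtype g := fun a =>
    Ideal.Quotient.eq_zero_iff_mem.trans ⟨fun ha => ⟨⟨a, ha⟩, rfl⟩, fun ⟨x, hx⟩ => hx ▸ x.2⟩
  constructor
  · exact fun hT i => (isZero_torGroup_add_two_iff _ hf h hg i).1 (hT (i + 2) (by omega))
  · intro hT n hn
    match n, hn with
    | 1, _ =>
      exact (isZero_torGroup_one_iff _ hf h hg).2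
        ((quotientTensor_map_injective_iff I _).2 fun x _ => mem_idealAeA_smul_top he x)
    | n + 2, _ => exact (isZero_torGroup_add_two_iff _ hf h hg n).2 (hT n)

theorem isHomologicalEpi_iff_isStratifyingIdeal :
    IsHomologicalEpi (Ideal.Quotient.mk (idealAeA e)) ↔ IsStratifyingIdeal he := by
  have hiso (n : ℕ) := ((((tensorFunctor (ModuleCat.of (he.Corner)ᵐᵒᵖ (groupAe e))).leftDerived
    n).mapIso (cornerIdealEquiv he).toModuleIso)).isZero_iff
  rw [IsHomologicalEpi, IsStratifyingIdeal, isZero_torGroup_quotient_iff he,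
    cornerMul_bijective_iff, and_iff_right (epiMul_mk_bijective _)]
  constructor
  · intro hT
    refine ⟨cornerCounit_injective_of_isZero_tor he _ (mem_idealAeA_smul_top he) (hT 0),
      fun n hn => ?_⟩
    obtain ⟨n, rfl⟩ := Nat.exists_eq_add_of_le' hn
    exact (hiso (n + 1)).1 (isZero_corner_tor_of_isZero_tor he n _ (mem_idealAeA_smul_top he) hT)
  · rintro ⟨hε, hT⟩ n
    exact isZero_tor_of_isZero_corner_tor he n _ (mem_idealAeA_smul_top he) hε
      fun i => (hiso (i + 1)).2 (hT (i + 1) (by omega))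

end CornerSyzygy

/-! ### Assembly of the equivalences. -/

theorem isStrongIdempotentIdeal_iff_isHomologicalEpi {A : Type u} [Ring A] [IsNoetherianRing A]
    (I : Ideal A) [I.IsTwoSided] :
    IsStrongIdempotentIdeal I ↔ IsHomologicalEpi (Ideal.Quotient.mk I) := by
  rw [isStrongIdempotentIdeal_iff, IsHomologicalEpi, and_iff_right (epiMul_mk_bijective I)]
  constructor
  · intro h n hn
    obtain ⟨n, rfl⟩ := Nat.exists_eq_add_of_le' hn
    have : Module.Finite A (leftVia (Ideal.Quotient.mk I)) :=
      Module.Finite.of_surjective (quotientToLeftVia I) Ideal.Quotient.mk_surjective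
    exact isZero_tor_of_subsingleton_ext I n (leftVia (Ideal.Quotient.mk I)) h
  · intro h Y _ i
    have hT (j : ℕ) : Limits.IsZero (torGroup A (j + 1) (rightVia (Ideal.Quotient.mk I))
        (ModuleCat.of A (leftVia (Ideal.Quotient.mk I)))) := h (j + 1) (by omega)
    exact subsingleton_ext_of_isZero_tor I i _ hT (leftVia_quotient_projective I) Y

end

theorem mainTheorem5 {k : Type*} [Field k] {A : Type u} [Ring A] [Algebra k A]
    [FiniteDimensional k A] (S : Subalgebra k A) [IsSemisimpleRing S]
    (e : A) (heS : e ∈ S) (he : IsIdempotentElem e) :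
    List.TFAE [
      IsRelStratifying S.toSubring e,
      IsStrongIdempotentIdeal (idealAeA e),
      IsHomologicalEpi (Ideal.Quotient.mk (idealAeA e)),
      IsStratifyingIdeal he] := by
  have hA : IsNoetherianRing A := isNoetherian_of_tower k inferInstance
  have hS : IsSemisimpleRing S.toSubring := inferInstanceAs (IsSemisimpleRing S)
  tfae_have 1 ↔ 3 := by
    rw [IsHomologicalEpi, and_iff_right (epiMul_mk_bijective _)]
    exact forall_congr' fun n => forall_congr' fun _ => isZero_relTor_iff S.toSubring n _ _
  tfae_have 2 ↔ 3 := isStrongIdempotentIdeal_iff_isHomologicalEpi _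
  tfae_have 3 ↔ 4 := isHomologicalEpi_iff_isStratifyingIdeal he
  tfae_finish
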